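/- Let $d_v,d_c,l$ be fixed non-negative integers (in practice $d_v,d_c\ge 1$). There exist positive constants $\beta=\beta(d_v,d_c,l)$ and $\gamma=\gamma(d_v,d_c,l)$, depending on nothing else, such that the following holds for every finite set $\mathcal Y$, every probability distribution $P(x,y)$ on $\{0,1\}\times\mathcal Y$, all $n,m$ with $nd_v=md_c$, every $\epsilon>0$, provided $n>2\gamma/\epsilon$: $$\Pr\{|Z-nd_vp_e^{(l)}|>nd_v\epsilon\}\le 2e^{-\beta\epsilon^2n}.$$ Here the probability is over a random graph and an independent source realization. The graph belongs to the $(d_v,d_c)$-regular LDPC ensemble of length $n$: $n$ variable nodes with $d_v$ sockets each and $m$ check nodes with $d_c$ sockets each are joined by a uniformly random bijection between variable sockets and check sockets (multiple edges are allowed; the parity-check matrix $H$ has as entry $H_{cv}$ the parity of the number of edges between $c$ and $v$). The source realization consists of i.i.d. pairs $(x_v,y_v)\sim P$, $v=1,\dots,n$, and the syndrome is $\mathbf s=H\mathbf x$ (mod 2). Messages take values in $[-\infty,\infty]$ and are sent along edges according to the Slepian–Wolf belief-propagation rules $$m^{(0)}_{vc}=m_0,\qquad m^{(l)}_{vc}=m_0+\sum_{c'\in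 C_v\setminus\{c\}}m^{(l)}_{c'v}\ (l\ge1),\qquad m^{(l)}_{cv}=(-1)^{s_c}\,\gamma_{\rm BP}^{-1}\Big(\sum_{v'\in V_c\setminus\{v\}}\gamma_{\rm BP}\big(m^{(l-1)}_{v'c}\big)\Big),$$ where $m_0=\ln\frac{P(0,y_v)}{P(1,y_v)}$, $\gamma_{\rm BP}(t)=(\operatorname{sgn}t,-\ln\tanh|t/2|)$, and the sums are over the edges at $v$ (resp. at $c$) other than the one along which the message is sent. $Z$ is the number of incorrect messages among the $nd_v$ variable-to-check messages of iteration $l$: a message from $v$ is incorrect if it is negative and $x_v=0$ or positive and $x_v=1$, and a message equal to $0$ counts as one half of an incorrect message. Finally, for $x\in\{0,1\}$ let $P^{(l)}(x)$ be the law, conditioned on the value of the sending variable being $x$, of the message of iteration $l$ when the directed neighbourhood of depth $2l$ of the edge is a tree (the sending variable node has $d_v-1$ child check nodes, each of which has $d_c-1$ child variable nodes, and so on), with i.i.d. source pairs $\sim P$ at the variable nodes and the corresponding syndrome bits at the check nodes. With $p=P(X=0)$ and $I(t)=-t$ put $\langle P^{(l)}\rangle=pP^{(l)}(0)+(1-p)P^{(l)}(1)\circ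 I^{-1}$ and $$p_e^{(l)}=\langle P^{(l)}\rangle\big([-\infty,0)\big)+\tfrac12\langle P^{(l)}\rangle(\{0\}).$$ -/

import Mathlib

open scoped ENNReal

universe u

noncomputable section

namespace SlepianWolf

/-! ### The message maps -/

/-- The decreasing involution `a ↦ -ln tanh (a / 2)` of `[0, ∞]`, with `0 ↦ ∞` and `∞ ↦ 0`. -/
def negLogTanhHalf (a : ℝ≥0∞) : ℝ≥0∞ :=
  if a = 0 then ⊤ else if a = ⊤ then 0
  else ENNReal.ofReal (-Real.log (Real.tanh (a.toReal / 2)))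

/-- `γ(m) = (sgn m, -ln tanh |m / 2|)`; the sign is written additively (`1` means negative), so that
sums are taken in the additive monoid `ZMod 2 × [0, ∞]`. The sign attached to `m = 0` is
irrelevant, because the second component is then infinite. -/
def gamma (m : EReal) : ZMod 2 × ℝ≥0∞ :=
  (if m < 0 then 1 else 0, negLogTanhHalf m.abs)

/-- `(-1) ^ s * m` for a bit `s`. -/
def flipBy (s : ZMod 2) (m : EReal) : EReal :=
  if s = 0 then m else -m

/-- The inverse of `γ`. -/
def gammaInv (p : ZMod 2 × ℝ≥0∞) : EReal :=
  flipBy p.1 (negLogTanhHalf p.2 : ℝ≥0∞)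

/-- The message `(-1) ^ s * γ⁻¹ (∑ γ (mᵢ))` sent by a check node with syndrome bit `s`, where
`mᵢ`, `i ∈ S`, are the messages received along the other edges. -/
def checkMsg {ι : Type*} (s : ZMod 2) (S : Finset ι) (msg : ι → EReal) : EReal :=
  flipBy s (gammaInv (∑ i ∈ S, gamma (msg i)))

variable {Y : Type u}

/-- The initial message `ln (P(0, y) / P(1, y))`, with values in `[-∞, ∞]`. -/
def initMsg (P : PMF (ZMod 2 × Y)) (y : Y) : EReal :=
  ENNReal.log (P (0, y) / P (1, y))

/-- The law of a family of i.i.d. random variables with common law `P`, indexed by `ι`. -/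
def iid {ι α : Type*} [Fintype ι] [DecidableEq ι] [Fintype α] (P : PMF α) : PMF (ι → α) :=
  PMF.ofFintype (fun ω => ∏ i, P (ω i)) (by
    have h : ∑ a, P a = 1 := by rw [← tsum_fintype (L := .unconditional _)]; exact P.tsum_coe
    have := (Finset.prod_univ_sum (fun _ : ι => (Finset.univ : Finset α)) (fun _ a => P a)).symm
    simpa [h] using this)

/-! ### Belief propagation on a graph of the ensemble

A graph with `n` variable nodes of degree `dv` and `m` check nodes of degree `dc` is a bijection
between the variable sockets and the check sockets. An edge is named by its variable socket. -/

/-- Labelled bipartite (multi)graphs, as matchings of sockets. -/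
abbrev Graph (dv dc n m : ℕ) : Type := (Fin n × Fin dv) ≃ (Fin m × Fin dc)

/-- The parity-check matrix: entry `(c, v)` is the number of edges joining `v` and `c`, mod 2. -/
def parityCheck {dv dc n m : ℕ} (G : Graph dv dc n m) : Matrix (Fin m) (Fin n) (ZMod 2) :=
  Matrix.of fun c v => ((Finset.univ.filter fun i : Fin dv => (G (v, i)).1 = c).card : ZMod 2)

/-- The syndrome `s = H x` of the source word. -/
def syndrome {dv dc n m : ℕ} (G : Graph dv dc n m) (ω : Fin n → ZMod 2 × Y) : Fin m → ZMod 2 :=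
  (parityCheck G).mulVec fun v => (ω v).1

/-- The message sent in iteration `l` from the variable node to the check node of the edge `e`,
for the source realization `ω = (xᵥ, yᵥ)ᵥ`. -/
def varMsg (P : PMF (ZMod 2 × Y)) {dv dc n m : ℕ} (G : Graph dv dc n m)
    (ω : Fin n → ZMod 2 × Y) : ℕ → Fin n × Fin dv → EReal
  | 0, e => initMsg P (ω e.1).2
  | l + 1, e => initMsg P (ω e.1).2 +
      ∑ i ∈ Finset.univ.erase e.2,
        checkMsg (syndrome G ω (G (e.1, i)).1) (Finset.univ.erase (G (e.1, i)).2)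
          (fun k => varMsg P G ω l (G.symm ((G (e.1, i)).1, k)))

/-- The contribution of a message `msg` about a bit `x` to the number of incorrect messages:
`1` if its sign is wrong, `0` if its sign is right, and `1 / 2` if the message is `0`. -/
def errorWeight (x : ZMod 2) (msg : EReal) : ℝ :=
  if flipBy x msg < 0 then 1 else if flipBy x msg = 0 then 1 / 2 else 0

/-- The number of incorrect messages among the `n * dv` variable-to-check messages of
iteration `l`. -/
def numIncorrect (P : PMF (ZMod 2 × Y)) {dv dc n m : ℕ} (l : ℕ) (G : Graph dv dc n m)
    (ω : Fin n → ZMod 2 × Y) : ℝ :=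
  ∑ e : Fin n × Fin dv, errorWeight (ω e.1).1 (varMsg P G ω l e)

/-- The `(dv, dc)`-regular ensemble of length `n`: the uniform distribution on graphs. -/
def ensemble {dv dc n m : ℕ} (h : n * dv = m * dc) : PMF (Graph dv dc n m) :=
  haveI : Nonempty (Graph dv dc n m) := ⟨Fintype.equivOfCardEq (by simpa using h)⟩
  PMF.uniformOfFintype (Graph dv dc n m)

/-- The joint law of the random graph and of an independent i.i.d. source realization. -/
def jointLaw [Fintype Y] (P : PMF (ZMod 2 × Y)) {dv dc n m : ℕ} (h : n * dv = m * dc) :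
    PMF (Graph dv dc n m × (Fin n → ZMod 2 × Y)) :=
  (ensemble h).bind fun G => (iid P).map fun ω => (G, ω)

/-! ### The tree assumption and the error probability of density evolution -/

/-- The variable nodes of the tree-like directed neighbourhood of depth `2 * l` of an edge: a root
and, below it, `dv - 1` check nodes, each with `dc - 1` further subtrees of depth `2 * (l - 1)`. -/
def TreeNode (dv dc : ℕ) : ℕ → Type
  | 0 => Unit
  | l + 1 => Option ((Fin (dv - 1) × Fin (dc - 1)) × TreeNode dv dc l)

instance treeNodeFintype (dv dc : ℕ) : (l : ℕ) → Fintype (TreeNode dv dc l)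
  | 0 => inferInstanceAs (Fintype Unit)
  | l + 1 =>
    haveI := treeNodeFintype dv dc l
    inferInstanceAs (Fintype (Option ((Fin (dv - 1) × Fin (dc - 1)) × TreeNode dv dc l)))

instance treeNodeDecidableEq (dv dc : ℕ) : (l : ℕ) → DecidableEq (TreeNode dv dc l)
  | 0 => inferInstanceAs (DecidableEq Unit)
  | l + 1 =>
    haveI := treeNodeDecidableEq dv dc l
    inferInstanceAs (DecidableEq (Option ((Fin (dv - 1) × Fin (dc - 1)) × TreeNode dv dc l)))

/-- The root of the tree. -/
def treeRoot (dv dc : ℕ) : (l : ℕ) → TreeNode dv dc l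
  | 0 => ()
  | _ + 1 => none

/-- The message sent by the root in iteration `l`, for a source realization on the tree. -/
def treeMsg (P : PMF (ZMod 2 × Y)) (dv dc : ℕ) :
    (l : ℕ) → (TreeNode dv dc l → ZMod 2 × Y) → EReal
  | 0, ω => initMsg P (ω (treeRoot dv dc 0)).2
  | l + 1, ω => initMsg P (ω (treeRoot dv dc (l + 1))).2 +
      ∑ i : Fin (dv - 1),
        checkMsg
          ((ω (treeRoot dv dc (l + 1))).1
            + ∑ j : Fin (dc - 1), (ω (some ((i, j), treeRoot dv dc l))).1)
          Finset.univ
          (fun j : Fin (dc - 1) => treeMsg P dv dc l fun t => ω (some ((i, j), t)))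

/-- `P⁽ˡ⁾(x)`: the law of the message of iteration `l` on the tree, conditioned on the event that
the value of the sending variable is `x` (the zero measure if this event has probability `0`). -/
def condMsgLaw [Fintype Y] (P : PMF (ZMod 2 × Y)) (dv dc l : ℕ) (x : ZMod 2) :
    MeasureTheory.Measure EReal :=
  letI : MeasurableSpace (TreeNode dv dc l → ZMod 2 × Y) := ⊤
  MeasureTheory.Measure.map (treeMsg P dv dc l)
    (ProbabilityTheory.cond (iid P : PMF (TreeNode dv dc l → ZMod 2 × Y)).toMeasure
      {ω | (ω (treeRoot dv dc l)).1 = x})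

/-- The probability `P(X = x)`. -/
def probX [Fintype Y] (P : PMF (ZMod 2 × Y)) (x : ZMod 2) : ℝ≥0∞ := ∑ y, P (x, y)

/-- `⟨P⁽ˡ⁾⟩ = p P⁽ˡ⁾(0) + (1 - p) P⁽ˡ⁾(1) ∘ I⁻¹`, where `p = P(X = 0)` and `I(m) = -m`. -/
def avgMsgLaw [Fintype Y] (P : PMF (ZMod 2 × Y)) (dv dc l : ℕ) : MeasureTheory.Measure EReal :=
  probX P 0 • condMsgLaw P dv dc l 0 +
    (1 - probX P 0) • (condMsgLaw P dv dc l 1).map (fun m => -m)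

/-- `p_e⁽ˡ⁾ = ⟨P⁽ˡ⁾⟩([-∞, 0)) + ⟨P⁽ˡ⁾⟩({0}) / 2`. -/
def errorProb [Fintype Y] (P : PMF (ZMod 2 × Y)) (dv dc l : ℕ) : ℝ :=
  (avgMsgLaw P dv dc l).real (Set.Iio 0) + 1 / 2 * (avgMsgLaw P dv dc l).real {0}

end SlepianWolf

end

noncomputable section

namespace SlepianWolf

/-! The proof bounds the fluctuation of `Z` about its mean by bounded differences, and shows that
this mean differs from `n * dv * errorProb` by at most a constant `C(dv, dc, l)`. When `n * ε` is
large compared with `C`, this bias uses up at most half of the allowed deviation.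

Fluctuation: by `varMsg_eq_treeMsg`, the message on `e` is always `treeMsg` evaluated on the source
pulled back along `unwrap G l e`, a map from the abstract tree to the graph. Tree nodes are reached
by walks along fixed words, and for a fixed word the walk is a permutation of the half-edges. Hence
exchanging two sockets of the graph, or changing one source pair, alters only boundedly many
messages. Uniform permutations and i.i.d. families satisfy a sub-Gaussian moment bound under such
conditions (`isSubGaussian_perm`, `isSubGaussian_pi`), and `IsSubGaussian.prod` combines the two
sources of randomness.

Mean: if the walks from `e` end at distinct nodes, `unwrap` is injective, the pulled-back source is
i.i.d., and the expected error on `e` is exactly `errorProb` (`sum_errorWeight_of_simple`). A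
switching argument (`card_collision_mul_le`) shows that this fails for a fraction `O(1 / n)` of the
graphs. Summing over the `n * dv` edges leaves a bounded error (`abs_mean_sub_le`). -/

/-! ### Half-edges and walks -/

/-- The `d - 1` nontrivial rotations of `Fin d`. -/
def rot : (d : ℕ) → Fin (d - 1) → Equiv.Perm (Fin d)
  | 0, i => i.elim0
  | _ + 1, i => Equiv.addLeft (Fin.succ i)

lemma rot_ne {d : ℕ} (i : Fin (d - 1)) (k : Fin d) : rot d i k ≠ k := by
  cases d with
  | zero => exact k.elim0
  | succ d =>
    intro h
    have h' : Fin.succ (n := d) i + k = k := h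
    exact Fin.succ_ne_zero _ (add_eq_right.mp h')

lemma rot_injective {d : ℕ} (k : Fin d) : Function.Injective fun i => rot d i k := by
  cases d with
  | zero => exact k.elim0
  | succ d =>
    intro i j h
    have h' : Fin.succ (n := d) i + k = Fin.succ (n := d) j + k := h
    exact Fin.succ_injective _ (add_right_cancel h')

lemma image_rot {d : ℕ} (k : Fin d) :
    Finset.univ.image (fun i => rot d i k) = Finset.univ.erase k := by
  apply Finset.eq_of_subset_of_card_le
  · intro x hx
    obtain ⟨i, -, rfl⟩ := Finset.mem_image.mp hx
    simp [rot_ne]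
  · rw [Finset.card_image_of_injective _ (rot_injective k)]
    simp

/-- Indexing the other sockets of a node by a fixed `Fin (d - 1)` matches them with the children in
the tree, and makes each choice of child a permutation of the sockets. -/
lemma sum_erase_eq_sum_rot {d : ℕ} {M : Type*} [AddCommMonoid M] (k : Fin d) (F : Fin d → M) :
    ∑ i ∈ Finset.univ.erase k, F i = ∑ i : Fin (d - 1), F (rot d i k) := by
  rw [← image_rot, Finset.sum_image fun i _ j _ h => rot_injective k h]

variable {dv dc n m : ℕ}

/-- The half-edges of a graph: the sockets of the variable nodes and of the check nodes. -/
abbrev HalfEdge (dv dc n m : ℕ) : Type := (Fin n × Fin dv) ⊕ (Fin m × Fin dc)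

/-- The half-edge matched with a given one. -/
def mate (G : Graph dv dc n m) : Equiv.Perm (HalfEdge dv dc n m) :=
  (Equiv.sumCongr G G.symm).trans (Equiv.sumComm _ _)

@[simp] lemma mate_inl (G : Graph dv dc n m) (e : Fin n × Fin dv) :
    mate G (.inl e) = .inr (G e) := rfl

@[simp] lemma mate_inr (G : Graph dv dc n m) (e : Fin m × Fin dc) :
    mate G (.inr e) = .inl (G.symm e) := rfl

@[simp] lemma mate_mate (G : Graph dv dc n m) (z : HalfEdge dv dc n m) :
    mate G (mate G z) = z := by
  cases z <;> simp

lemma isLeft_mate (G : Graph dv dc n m) (z : HalfEdge dv dc n m) :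
    (mate G z).isLeft = !z.isLeft := by
  cases z <;> rfl

/-- The node to which a half-edge is attached. -/
def node (z : HalfEdge dv dc n m) : Fin n ⊕ Fin m := Sum.map Prod.fst Prod.fst z

/-- The steps of a walk: a rotation at a variable node or at a check node. -/
abbrev Letter (dv dc : ℕ) : Type := Fin (dv - 1) ⊕ Fin (dc - 1)

/-- The rotation of the half-edges at each node prescribed by a letter. -/
def turn : Letter dv dc → Equiv.Perm (HalfEdge dv dc n m)
  | .inl i => Equiv.sumCongr (Equiv.prodCongr (Equiv.refl _) (rot dv i)) (Equiv.refl _)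
  | .inr j => Equiv.sumCongr (Equiv.refl _) (Equiv.prodCongr (Equiv.refl _) (rot dc j))

@[simp] lemma node_turn (k : Letter dv dc) (z : HalfEdge dv dc n m) :
    node (turn k z) = node z := by
  cases k <;> cases z <;> rfl

@[simp] lemma isLeft_turn (k : Letter dv dc) (z : HalfEdge dv dc n m) :
    (turn k z).isLeft = z.isLeft := by
  cases k <;> cases z <;> rfl

/-- A letter fixes every half-edge of the opposite side, so it moves `z` only when the sides agree.
-/
lemma turn_ne (k : Letter dv dc) (z : HalfEdge dv dc n m) (h : k.isLeft = z.isLeft) :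
    turn k z ≠ z := by
  rcases k with i | j <;> rcases z with ⟨v, x⟩ | ⟨c, x⟩
  · simp [turn, rot_ne]
  · simp at h
  · simp at h
  · simp [turn, rot_ne]

lemma turn_inj (k k' : Letter dv dc) (z : HalfEdge dv dc n m) (h : k.isLeft = z.isLeft)
    (h' : k'.isLeft = z.isLeft) (hk : turn k z = turn k' z) : k = k' := by
  rcases k with i | i <;> rcases k' with j | j <;> rcases z with ⟨v, x⟩ | ⟨c, x⟩ <;>
    simp [turn] at h h' hk ⊢
  · exact rot_injective x hk
  · exact rot_injective x hk

/-- The endpoint of the walk along a word, as a function of the starting half-edge. The last letter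
of the list is the first step. -/
def walk (G : Graph dv dc n m) : List (Letter dv dc) → Equiv.Perm (HalfEdge dv dc n m)
  | [] => Equiv.refl _
  | k :: s => ((walk G s).trans (turn k)).trans (mate G)

@[simp] lemma walk_nil (G : Graph dv dc n m) (z : HalfEdge dv dc n m) : walk G [] z = z := rfl

@[simp] lemma walk_cons (G : Graph dv dc n m) (k : Letter dv dc) (s : List (Letter dv dc))
    (z : HalfEdge dv dc n m) : walk G (k :: s) z = mate G (turn k (walk G s z)) := rfl

lemma walk_append (G : Graph dv dc n m) (s t : List (Letter dv dc)) (z : HalfEdge dv dc n m) :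
    walk G (s ++ t) z = walk G s (walk G t z) := by
  induction s with
  | nil => rfl
  | cons k s ih => simp [ih]

lemma isLeft_walk (G : Graph dv dc n m) (s : List (Letter dv dc)) (e : Fin n × Fin dv) :
    (walk G s (.inl e)).isLeft = decide (Even s.length) := by
  induction s with
  | nil => simp
  | cons k s ih => simp [isLeft_mate, ih, Nat.even_add_one, -Nat.not_even_iff_odd]

lemma card_node_eq_le (ν : Fin n ⊕ Fin m) :
    (Finset.univ.filter fun z : HalfEdge dv dc n m => node z = ν).card ≤ dv + dc := by
  rcases ν with v | c
  · calc _ ≤ (Finset.univ.image fun x : Fin dv => (.inl (v, x) : HalfEdge dv dc n m)).card := by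
          apply Finset.card_le_card
          rintro (⟨v', x⟩ | ⟨c, x⟩) hz <;> have h := (Finset.mem_filter.mp hz).2 <;>
            simp [node] at h
          simp [h]
      _ ≤ _ := Finset.card_image_le
      _ ≤ _ := by simp
  · calc _ ≤ (Finset.univ.image fun x : Fin dc => (.inr (c, x) : HalfEdge dv dc n m)).card := by
          apply Finset.card_le_card
          rintro (⟨v', x⟩ | ⟨c, x⟩) hz <;> have h := (Finset.mem_filter.mp hz).2 <;>
            simp [node] at h
          simp [h]
      _ ≤ _ := Finset.card_image_le
      _ ≤ _ := by simp

/-! ### Switchings -/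

/-- Exchange the partners of the half-edges `a` and `b`, if these are on the same side. -/
def switch (G : Graph dv dc n m) : HalfEdge dv dc n m → HalfEdge dv dc n m → Graph dv dc n m
  | .inl a, .inl b => (Equiv.swap a b).trans G
  | .inr a, .inr b => G.trans (Equiv.swap a b)
  | _, _ => G

lemma swap_map_apply {α β : Type*} [DecidableEq α] [DecidableEq β] {f : α → β}
    (hf : Function.Injective f) (a b x : α) :
    Equiv.swap (f a) (f b) (f x) = f (Equiv.swap a b x) :=
  (hf.map_swap _ _ _).symm

/-- Switching conjugates the matching by a transposition, a form that treats variable and check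
sockets alike. -/
lemma mate_switch (G : Graph dv dc n m) {a b : HalfEdge dv dc n m} (h : a.isLeft = b.isLeft)
    (z : HalfEdge dv dc n m) :
    mate (switch G a b) z = Equiv.swap a b (mate G (Equiv.swap a b z)) := by
  rcases a with a | a <;> rcases b with b | b <;> simp at h <;> rcases z with z | z
  · rw [swap_map_apply Sum.inl_injective]
    simp [switch, Equiv.swap_apply_of_ne_of_ne]
  · have hz : Equiv.swap (Sum.inl a) (Sum.inl b) (Sum.inr z : HalfEdge dv dc n m) = Sum.inr z :=
      Equiv.swap_apply_of_ne_of_ne (by simp) (by simp)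
    rw [hz, mate_inr, mate_inr, swap_map_apply Sum.inl_injective]
    simp [switch]
  · have hz : Equiv.swap (Sum.inr a) (Sum.inr b) (Sum.inl z : HalfEdge dv dc n m) = Sum.inl z :=
      Equiv.swap_apply_of_ne_of_ne (by simp) (by simp)
    rw [hz, mate_inl, mate_inl, swap_map_apply Sum.inr_injective]
    simp [switch]
  · rw [swap_map_apply Sum.inr_injective]
    simp [switch, Equiv.swap_apply_of_ne_of_ne]

lemma switch_switch (G : Graph dv dc n m) (a b : HalfEdge dv dc n m) :
    switch (switch G a b) a b = G := by
  rcases a with a | a <;> rcases b with b | b <;> simp only [switch]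
  · ext x <;> simp
  · ext x <;> simp

lemma card_mate_switch_ne_le (G : Graph dv dc n m) {a b : HalfEdge dv dc n m}
    (h : a.isLeft = b.isLeft) :
    (Finset.univ.filter fun z => mate (switch G a b) z ≠ mate G z).card ≤ 4 := by
  refine (Finset.card_le_card (t := {a, b, mate G a, mate G b}) ?_).trans Finset.card_le_four
  intro z hz
  by_contra hn
  simp only [Finset.mem_insert, Finset.mem_singleton, not_or] at hn
  obtain ⟨h1, h2, h3, h4⟩ := hn
  rw [Finset.mem_filter, mate_switch G h, Equiv.swap_apply_of_ne_of_ne h1 h2,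
    Equiv.swap_apply_of_ne_of_ne] at hz
  · exact hz.2 rfl
  · rintro rfl; simp at h3
  · rintro rfl; simp at h4

/-- Two walks that still agree can separate only by crossing one of the at most four rematched
half-edges. The prefix of the walk is a permutation, so each step spoils at most four starting
points. -/
lemma card_walk_switch_ne_le (G : Graph dv dc n m) {a b : HalfEdge dv dc n m}
    (h : a.isLeft = b.isLeft) (s : List (Letter dv dc)) :
    (Finset.univ.filter fun z => walk (switch G a b) s z ≠ walk G s z).card ≤ 4 * s.length := by
  induction s with
  | nil => simp
  | cons k s ih =>
    have hsub : (Finset.univ.filter fun z =>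
          walk (switch G a b) (k :: s) z ≠ walk G (k :: s) z) ⊆
        (Finset.univ.filter fun z => walk (switch G a b) s z ≠ walk G s z) ∪
        (Finset.univ.filter fun z => mate (switch G a b) z ≠ mate G z).map
          ((walk G s).trans (turn k)).symm.toEmbedding := by
      intro z hz
      by_cases hw : walk (switch G a b) s z = walk G s z
      · apply Finset.mem_union_right
        rw [Finset.mem_map_equiv]
        simpa [hw] using (Finset.mem_filter.mp hz).2
      · exact Finset.mem_union_left _ (by simpa using hw)
    calc _ ≤ _ := Finset.card_le_card hsub
      _ ≤ _ := Finset.card_union_le _ _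
      _ ≤ 4 * s.length + 4 := by
        rw [Finset.card_map]
        exact add_le_add ih (card_mate_switch_ne_le G h)
      _ = _ := by simp; ring

/-- The walk along a fixed word is a permutation, so no more starting points lead to a node than it
has sockets. -/
lemma card_node_walk_eq_le (G : Graph dv dc n m) (s : List (Letter dv dc)) (ν : Fin n ⊕ Fin m) :
    (Finset.univ.filter fun z => node (walk G s z) = ν).card ≤ dv + dc := by
  calc _ = ((Finset.univ.filter fun z : HalfEdge dv dc n m => node z = ν).map
        (walk G s).symm.toEmbedding).card := by
        congr 1
        ext z
        rw [Finset.mem_map_equiv]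
        simp
    _ ≤ _ := by
        rw [Finset.card_map]
        exact card_node_eq_le ν

/-! ### Collisions are rare -/

/-- Sets of words that contain with each word the walks leading to it, and whose letters rotate at
the nodes where they are applied, when walks start at variable nodes. -/
structure Explorable (T : Finset (List (Letter dv dc))) : Prop where
  tail : ∀ k s, k :: s ∈ T → s ∈ T
  parity : ∀ k s, k :: s ∈ T → k.isLeft = decide (Even s.length)

/-- The walks along the words of `T`, starting from `e`, end at distinct nodes. -/
def Simple (T : Finset (List (Letter dv dc))) (e : Fin n × Fin dv) (G : Graph dv dc n m) : Prop :=
  Set.InjOn (fun s => node (walk G s (.inl e))) (T : Set (List (Letter dv dc)))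

/-- The half-edges whose partners are known from the walks along the words of `T`. -/
def revealed (T : Finset (List (Letter dv dc))) (e : Fin n × Fin dv) (G : Graph dv dc n m) :
    Finset (HalfEdge dv dc n m) :=
  T.image (fun t => walk G t (.inl e)) ∪ T.image (fun t => mate G (walk G t (.inl e)))

lemma card_revealed_le (T : Finset (List (Letter dv dc))) (e : Fin n × Fin dv)
    (G : Graph dv dc n m) : (revealed T e G).card ≤ 2 * T.card := by
  refine (Finset.card_union_le _ _).trans ?_
  have h1 := Finset.card_image_le (s := T) (f := fun t => walk G t (.inl e))
  have h2 := Finset.card_image_le (s := T) (f := fun t => mate G (walk G t (.inl e)))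
  omega

/-- Redirecting the last step of `k :: s` to an unrevealed `z` leaves the walks of `T` intact: a
simple exploration that omits `k :: s` never crosses the edge of that last step in either direction.
-/
lemma walk_switch_eq {T : Finset (List (Letter dv dc))} (hT : Explorable T) {e : Fin n × Fin dv}
    {G : Graph dv dc n m} (hG : Simple T e G) {k : Letter dv dc} {s : List (Letter dv dc)}
    (hs : s ∈ T) (hk : k.isLeft = decide (Even s.length)) (hks : k :: s ∉ T)
    {z : HalfEdge dv dc n m} (hz : z.isLeft = (walk G (k :: s) (.inl e)).isLeft)
    (hz' : z ∉ revealed T e G) :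
    ∀ t ∈ T, walk (switch G (walk G (k :: s) (.inl e)) z) t (.inl e) = walk G t (.inl e) := by
  intro t
  induction t with
  | nil => intro _; rfl
  | cons k' s' ih =>
    intro ht
    have hs' := hT.tail _ _ ht
    have hmem : ∀ t ∈ T, walk G t (.inl e) ≠ z ∧ mate G (walk G t (.inl e)) ≠ z := by
      refine fun t ht => ⟨?_, ?_⟩ <;> rintro rfl <;> apply hz'
      · exact Finset.mem_union_left _ (Finset.mem_image_of_mem _ ht)
      · exact Finset.mem_union_right _ (Finset.mem_image_of_mem (fun t => mate G (walk G t _)) ht)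
    obtain ⟨hne1, hne2⟩ := hmem _ ht
    rw [walk_cons _ k' s', walk_cons _ k' s', ih hs', mate_switch G hz.symm]
    rw [walk_cons G k' s'] at hne1 hne2
    rw [mate_mate] at hne2
    have hturn : turn k (walk G s (.inl e)) ≠ walk G s (.inl e) :=
      turn_ne _ _ (by rw [isLeft_walk, hk])
    rw [Equiv.swap_apply_of_ne_of_ne _ hne2, Equiv.swap_apply_of_ne_of_ne _ hne1]
    -- Crossing the edge forwards: simplicity forces `s' = s`, then `k' = k`, contradicting `k :: s
    -- ∉ T`.
    · intro h
      have h1 : turn k' (walk G s' (.inl e)) = turn k (walk G s (.inl e)) := by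
        rw [walk_cons] at h
        exact (mate G).injective h
      have h2 : s' = s := hG hs' hs (by
        simpa using congrArg node h1)
      subst h2
      have h3 : k' = k := turn_inj k' k _ (by rw [isLeft_walk, hT.parity _ _ ht])
        (by rw [isLeft_walk, hk]) h1
      subst h3
      exact hks ht
    -- Crossing it backwards: the walk would return to the node of `s` through a socket other than
    -- the one where `s` ends.
    · intro h
      have h1 : walk G (k' :: s') (.inl e) = turn k (walk G s (.inl e)) := by
        rw [walk_cons] at h
        rw [walk_cons, h, mate_mate]
      have h2 : k' :: s' = s := hG ht hs (by simpa using congrArg node h1)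
      rw [h2] at h1
      exact hturn h1.symm

lemma card_isLeft_eq (h : n * dv = m * dc) (b : Bool) :
    (Finset.univ.filter fun z : HalfEdge dv dc n m => z.isLeft = b).card = n * dv := by
  cases b
  · calc _ = (Finset.univ.map (Function.Embedding.inr :
          (Fin m × Fin dc) ↪ (Fin n × Fin dv) ⊕ (Fin m × Fin dc))).card := by
          congr 1
          ext (z | z) <;> simp
      _ = _ := by simp [h]
  · calc _ = (Finset.univ.map (Function.Embedding.inl :
          (Fin n × Fin dv) ↪ (Fin n × Fin dv) ⊕ (Fin m × Fin dc))).card := by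
          congr 1
          ext (z | z) <;> simp
      _ = _ := by simp

open Classical in
/-- Switching bound for the number of graphs in which one further step from a simple exploration
closes a cycle. -/
lemma card_collision_mul_le (h : n * dv = m * dc) {T : Finset (List (Letter dv dc))}
    (hT : Explorable T) (e : Fin n × Fin dv) {k : Letter dv dc} {s : List (Letter dv dc)}
    (hs : s ∈ T) (hk : k.isLeft = decide (Even s.length)) (hks : k :: s ∉ T) :
    (Finset.univ.filter fun G : Graph dv dc n m => Simple T e G ∧
      ∃ t ∈ T, node (walk G t (.inl e)) = node (walk G (k :: s) (.inl e))).card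
        * (n * dv - 2 * T.card)
      ≤ Fintype.card (Graph dv dc n m) * (T.card * (dv + dc)) := by
  set B := Finset.univ.filter fun G : Graph dv dc n m => Simple T e G ∧
      ∃ t ∈ T, node (walk G t (.inl e)) = node (walk G (k :: s) (.inl e)) with hB
  -- Double counting: `allowed` holds the new ends to which a colliding last step can be redirected,
  -- and `near` the sockets at nodes visited by `T`. Each bad graph has about `n * dv` of the
  -- former, and every graph has boundedly many of the latter.
  let allowed : Graph dv dc n m → Finset (HalfEdge dv dc n m) := fun G =>
    (Finset.univ.filter fun z => z.isLeft = (walk G (k :: s) (.inl e)).isLeft) \ revealed T e G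
  let near : Graph dv dc n m → Finset (HalfEdge dv dc n m) := fun G =>
    T.biUnion fun t => Finset.univ.filter fun z => node z = node (walk G t (.inl e))
  have hallowed : ∀ G, n * dv - 2 * T.card ≤ (allowed G).card := by
    intro G
    have h1 := Finset.le_card_sdiff (revealed T e G)
      (Finset.univ.filter fun z => z.isLeft = (walk G (k :: s) (.inl e)).isLeft)
    rw [card_isLeft_eq h] at h1
    have h2 := card_revealed_le T e G
    exact le_trans (by omega) h1
  have hnear : ∀ G, (near G).card ≤ T.card * (dv + dc) := fun G =>
    Finset.card_biUnion_le_card_mul _ _ _ fun t _ => card_node_eq_le _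
  have hout : ∀ (G : Graph dv dc n m) (z : HalfEdge dv dc n m), z.isLeft = (walk G (k :: s) (.inl e)).isLeft →
      turn k (walk G s (.inl e)) ≠ z := by
    rintro G z hz rfl
    rw [walk_cons, isLeft_mate, isLeft_turn] at hz
    exact (Bool.eq_not_self _).mp hz
  have hwalk : ∀ G ∈ B, ∀ z ∈ allowed G,
      walk (switch G (walk G (k :: s) (.inl e)) z) (k :: s) (.inl e) = z := by
    intro G hG z hz
    obtain ⟨hz1, hz2⟩ := Finset.mem_sdiff.mp hz
    replace hz1 := (Finset.mem_filter.mp hz1).2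
    rw [walk_cons (switch _ _ _),
      walk_switch_eq hT (Finset.mem_filter.mp hG).2.1 hs hk hks hz1 hz2 s hs,
      mate_switch G hz1.symm, Equiv.swap_apply_of_ne_of_ne (hout G _ rfl) (hout G z hz1),
      walk_cons, Equiv.swap_apply_left]
  calc B.card * (n * dv - 2 * T.card) ≤ (B.sigma allowed).card := by
        rw [Finset.card_sigma, ← smul_eq_mul]
        exact Finset.card_nsmul_le_sum _ _ _ fun G _ => hallowed G
    _ ≤ ((Finset.univ : Finset (Graph dv dc n m)).sigma near).card := by
        -- The pair (switched graph, old end) determines `(G, z)`: in the switched graph the walk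
        -- along `k :: s` ends at `z`, and switching is an involution. The old end is in `near`
        -- because the walks of `T` are unchanged.
        apply Finset.card_le_card_of_injOn
          (fun p => ⟨switch p.1 (walk p.1 (k :: s) (.inl e)) p.2, walk p.1 (k :: s) (.inl e)⟩)
        · rintro ⟨G, z⟩ hp
          obtain ⟨hG, hz⟩ := Finset.mem_sigma.mp hp
          obtain ⟨hz1, hz2⟩ := Finset.mem_sdiff.mp hz
          replace hz1 := (Finset.mem_filter.mp hz1).2
          obtain ⟨hsim, t, ht, hcol⟩ := (Finset.mem_filter.mp hG).2
          refine Finset.mem_sigma.mpr ⟨Finset.mem_univ _, Finset.mem_biUnion.mpr ⟨t, ht, ?_⟩⟩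
          refine Finset.mem_filter.mpr ⟨Finset.mem_univ _, ?_⟩
          dsimp only at hz1 hz2 ⊢
          rw [walk_switch_eq hT hsim hs hk hks hz1 hz2 t ht, hcol]
        · rintro ⟨G, z⟩ hp ⟨G', z'⟩ hp' heq
          obtain ⟨hG, hz⟩ := Finset.mem_sigma.mp hp
          obtain ⟨hG', hz'⟩ := Finset.mem_sigma.mp hp'
          simp only [Sigma.mk.injEq, heq_eq_eq] at heq
          obtain ⟨h1, h2⟩ := heq
          have h3 : z = z' := by
            rw [← hwalk G hG z hz, ← hwalk G' hG' z' hz', h1]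
          subst h3
          have h4 : G = G' := by
            rw [← switch_switch G (walk G (k :: s) (.inl e)) z, h1, h2, switch_switch]
          subst h4
          rfl
    _ ≤ _ := by
        rw [Finset.card_sigma, ← Finset.card_univ, ← smul_eq_mul]
        exact Finset.sum_le_card_nsmul _ _ _ fun G _ => hnear G

-- Words are added one at a time, each costing one collision bound. A common `M` bounding all sizes
-- keeps the factor `n * dv - 2 * M` fixed during the induction; the truncated subtraction makes the
-- bound trivial for small `n`.
open Classical in
lemma card_not_simple_mul_le (h : n * dv = m * dc) (e : Fin n × Fin dv) (M : ℕ) :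
    ∀ N : ℕ, N ≤ M → ∀ T : Finset (List (Letter dv dc)), Explorable T → T.card = N →
    (Finset.univ.filter fun G : Graph dv dc n m => ¬ Simple T e G).card * (n * dv - 2 * M)
      ≤ Fintype.card (Graph dv dc n m) * (N * (M * (dv + dc))) := by
  intro N
  induction N with
  | zero =>
    intro _ T hT hc
    rw [Finset.card_eq_zero] at hc
    subst hc
    simp [Simple]
  | succ N ih =>
    intro hN T hT hc
    have hne : T.Nonempty := Finset.card_pos.mp (by omega)
    -- A longest word is not the tail of another, so the remaining words are still explorable.
    obtain ⟨t, ht, hmax⟩ := Finset.exists_max_image T List.length hne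
    have hT' : Explorable (T.erase t) := by
      refine ⟨fun k s hks => ?_, fun k s hks => hT.parity k s (Finset.mem_of_mem_erase hks)⟩
      have hks' := Finset.mem_of_mem_erase hks
      refine Finset.mem_erase.mpr ⟨?_, hT.tail k s hks'⟩
      rintro rfl
      have := hmax _ hks'
      simp at this
    have hc' : (T.erase t).card = N := by rw [Finset.card_erase_of_mem ht, hc]; rfl
    have ih' := ih (by omega) _ hT' hc'
    have hins : insert t (T.erase t) = T := Finset.insert_erase ht
    cases t with
    | nil =>
      have hT0 : T = {[]} := by
        apply Finset.eq_singleton_iff_unique_mem.mpr ⟨ht, fun s hs => ?_⟩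
        have := hmax s hs
        simpa using this
      have : (Finset.univ.filter fun G : Graph dv dc n m => ¬ Simple T e G) = ∅ := by
        rw [Finset.filter_eq_empty_iff]
        rintro G -
        rw [not_not, hT0]
        simp [Simple]
      rw [this]
      simp
    | cons k s =>
      have hs : s ∈ T.erase (k :: s) :=
        Finset.mem_erase.mpr ⟨by simp, hT.tail _ _ ht⟩
      have hcol := card_collision_mul_le h hT' e hs (hT.parity _ _ ht)
        (Finset.notMem_erase _ _)
      set B := Finset.univ.filter fun G : Graph dv dc n m => Simple (T.erase (k :: s)) e G ∧
        ∃ t ∈ T.erase (k :: s), node (walk G t (.inl e)) = node (walk G (k :: s) (.inl e))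
      have hsub : (Finset.univ.filter fun G : Graph dv dc n m => ¬ Simple T e G) ⊆
          (Finset.univ.filter fun G : Graph dv dc n m => ¬ Simple (T.erase (k :: s)) e G) ∪ B := by
        intro G hG
        replace hG := (Finset.mem_filter.mp hG).2
        by_cases hsim : Simple (T.erase (k :: s)) e G
        · refine Finset.mem_union_right _ (Finset.mem_filter.mpr ⟨Finset.mem_univ _, hsim, ?_⟩)
          by_contra hno
          apply hG
          rw [← hins, Simple, Finset.coe_insert, Set.injOn_insert (by simp)]
          refine ⟨hsim, ?_⟩
          rintro ⟨t, ht', hteq⟩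
          exact hno ⟨t, ht', hteq⟩
        · exact Finset.mem_union_left _ (Finset.mem_filter.mpr ⟨Finset.mem_univ _, hsim⟩)
      rw [hc'] at hcol
      calc _ ≤ ((Finset.univ.filter fun G : Graph dv dc n m =>
            ¬ Simple (T.erase (k :: s)) e G).card + B.card) * (n * dv - 2 * M) :=
            Nat.mul_le_mul_right _ ((Finset.card_le_card hsub).trans (Finset.card_union_le _ _))
        _ ≤ Fintype.card (Graph dv dc n m) * (N * (M * (dv + dc))) +
            Fintype.card (Graph dv dc n m) * (M * (dv + dc)) := by
            rw [add_mul]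
            refine add_le_add ih' ((Nat.mul_le_mul_left _ ?_).trans (hcol.trans ?_))
            · omega
            · exact Nat.mul_le_mul_left _ (Nat.mul_le_mul_right _ (by omega))
        _ = _ := by ring

open Classical in
/-- A fixed exploration fails to be simple with probability `O(1 / n)`. -/
lemma card_mul_card_not_simple_le (h : n * dv = m * dc) (e : Fin n × Fin dv)
    {T : Finset (List (Letter dv dc))} (hT : Explorable T) :
    (n * dv) * (Finset.univ.filter fun G : Graph dv dc n m => ¬ Simple T e G).card
      ≤ (T.card ^ 2 * (dv + dc) + 2 * T.card) * Fintype.card (Graph dv dc n m) := by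
  have h1 := card_not_simple_mul_le h e T.card T.card le_rfl T hT rfl
  set b := (Finset.univ.filter fun G : Graph dv dc n m => ¬ Simple T e G).card
  have h2 : b ≤ Fintype.card (Graph dv dc n m) := Finset.card_le_univ _
  -- The subtracted `2 * T.card` is restored at the cost of the trivial bound `h2`, which covers
  -- small `n` too.
  have h3 : n * dv ≤ (n * dv - 2 * T.card) + 2 * T.card := by omega
  calc (n * dv) * b ≤ ((n * dv - 2 * T.card) + 2 * T.card) * b := Nat.mul_le_mul_right _ h3
    _ = b * (n * dv - 2 * T.card) + 2 * T.card * b := by ring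
    _ ≤ Fintype.card (Graph dv dc n m) * (T.card * (T.card * (dv + dc))) +
        2 * T.card * Fintype.card (Graph dv dc n m) := add_le_add h1 (Nat.mul_le_mul_left _ h2)
    _ = _ := by ring

variable {Y : Type u}

/-! ### The computation tree -/

/-- The edge above the subtree indexed by `(i, j)` in the computation tree of the message on `e`. -/
def childEdge (G : Graph dv dc n m) (e : Fin n × Fin dv) (i : Fin (dv - 1)) (j : Fin (dc - 1)) :
    Fin n × Fin dv :=
  G.symm ((G (e.1, rot dv i e.2)).1, rot dc j (G (e.1, rot dv i e.2)).2)

/-- The map of the computation tree of the message of iteration `l` on `e` to the graph. -/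
def unwrap (G : Graph dv dc n m) : (l : ℕ) → Fin n × Fin dv → TreeNode dv dc l → Fin n
  | 0, e, _ => e.1
  | _ + 1, e, none => e.1
  | l + 1, e, some ((i, j), t) => unwrap G l (childEdge G e i j) t

lemma unwrap_treeRoot (G : Graph dv dc n m) (l : ℕ) (e : Fin n × Fin dv) :
    unwrap G l e (treeRoot dv dc l) = e.1 := by
  cases l <;> rfl

/-- Summing over sockets counts multiple edges with multiplicity, which agrees modulo 2 with the
parity entries of `H`. -/
lemma syndrome_eq_sum (G : Graph dv dc n m) (ω : Fin n → ZMod 2 × Y) (c : Fin m) :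
    syndrome G ω c = ∑ k, (ω (G.symm (c, k)).1).1 := by
  have h1 : ∀ v, ((Finset.univ.filter fun i : Fin dv => (G (v, i)).1 = c).card : ZMod 2) * (ω v).1
      = ∑ i : Fin dv, if (G (v, i)).1 = c then (ω v).1 else 0 := by
    intro v
    rw [← Finset.sum_filter, Finset.sum_const, nsmul_eq_mul]
  calc syndrome G ω c
      = ∑ v, ∑ i : Fin dv, if (G (v, i)).1 = c then (ω v).1 else 0 := by
        simp only [syndrome, parityCheck, Matrix.mulVec, dotProduct, Matrix.of_apply, h1]
    _ = ∑ e : Fin n × Fin dv, if (G e).1 = c then (ω e.1).1 else 0 := by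
        rw [Fintype.sum_prod_type]
    _ = ∑ y : Fin m × Fin dc, if y.1 = c then (ω (G.symm y).1).1 else 0 := by
        refine Fintype.sum_equiv G _ _ fun e => ?_
        simp
    _ = _ := by
        rw [Fintype.sum_prod_type, Finset.sum_eq_single c]
        · simp
        · intro b _ hb
          simp [hb]
        · simp

lemma checkMsg_erase {d : ℕ} (s : ZMod 2) (k : Fin d) (msg : Fin d → EReal) :
    checkMsg s (Finset.univ.erase k) msg =
      checkMsg s Finset.univ fun j : Fin (d - 1) => msg (rot d j k) := by
  simp only [checkMsg, sum_erase_eq_sum_rot]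

/-- Belief propagation computes the message that the computation tree determines, whether or not
the tree embeds in the graph. -/
lemma varMsg_eq_treeMsg (P : PMF (ZMod 2 × Y)) (G : Graph dv dc n m) (ω : Fin n → ZMod 2 × Y)
    (l : ℕ) (e : Fin n × Fin dv) :
    varMsg P G ω l e = treeMsg P dv dc l fun t => ω (unwrap G l e t) := by
  induction l generalizing e with
  | zero => rfl
  | succ l ih =>
    simp only [varMsg, treeMsg]
    rw [sum_erase_eq_sum_rot]
    congr 1
    refine Finset.sum_congr rfl fun i _ => ?_
    rw [checkMsg_erase]
    congr 1
    -- The socket leading back to the sender contributes the root bit of the tree; the other sockets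
    -- contribute its grandchildren.
    · rw [syndrome_eq_sum, ← Finset.add_sum_erase _ _ (Finset.mem_univ (G (e.1, rot dv i e.2)).2),
        sum_erase_eq_sum_rot]
      congr 1
      · simp [unwrap, treeRoot]
      · refine Finset.sum_congr rfl fun j _ => ?_
        simp only [unwrap, unwrap_treeRoot, childEdge]
    · funext j
      rw [ih]
      rfl

/-- The word that leads from the root of the tree to a given node. -/
def treeWord : (l : ℕ) → TreeNode dv dc l → List (Letter dv dc)
  | 0, _ => []
  | _ + 1, none => []
  | l + 1, some ((i, j), t) => treeWord l t ++ [.inr j, .inl i]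

lemma node_walk_treeWord (G : Graph dv dc n m) (l : ℕ) (e : Fin n × Fin dv)
    (t : TreeNode dv dc l) :
    node (walk G (treeWord l t) (.inl e)) = .inl (unwrap G l e t) := by
  induction l generalizing e with
  | zero => rfl
  | succ l ih =>
    rcases t with _ | ⟨⟨i, j⟩, t⟩
    · rfl
    · simp only [treeWord, walk_append, unwrap]
      rw [← ih]
      rfl

lemma treeWord_injective (l : ℕ) :
    Function.Injective (treeWord l : TreeNode dv dc l → List (Letter dv dc)) := by
  induction l with
  | zero => exact fun _ _ _ => rfl
  | succ l ih =>
    rintro (_ | ⟨⟨i, j⟩, t⟩) (_ | ⟨⟨i', j'⟩, t'⟩) h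
    · rfl
    · simp [treeWord] at h
    · simp [treeWord] at h
    · simp only [treeWord] at h
      obtain ⟨h1, h2⟩ := List.append_inj' h rfl
      have h3 := ih h1
      simp only [List.cons.injEq, Sum.inr.injEq, Sum.inl.injEq] at h2
      obtain ⟨rfl, rfl, -⟩ := h2
      rw [h3]

lemma length_treeWord_le (l : ℕ) (t : TreeNode dv dc l) : (treeWord l t).length ≤ 2 * l := by
  induction l with
  | zero => exact le_rfl
  | succ l ih =>
    rcases t with _ | ⟨⟨i, j⟩, t⟩
    · simp [treeWord]
    · have := ih t
      simp only [treeWord, List.length_append, List.length_cons, List.length_nil]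
      omega

/-- Words consist of blocks (check rotation, variable rotation), read from the right. A suffix
either lies in the last block or contains it whole, and removing that block preserves the parity of
the length. -/
lemma parity_of_suffix_treeWord (l : ℕ) (t : TreeNode dv dc l) {k : Letter dv dc}
    {s : List (Letter dv dc)} (h : k :: s <:+ treeWord l t) :
    k.isLeft = decide (Even s.length) := by
  induction l generalizing k s with
  | zero => simp [treeWord] at h
  | succ l ih =>
    rcases t with _ | ⟨⟨i, j⟩, t⟩
    · simp [treeWord] at h
    · simp only [treeWord] at h
      obtain ⟨u, hu⟩ := h
      have hlast : ∀ c : List (Letter dv dc), c ++ k :: s = [.inr j, .inl i] →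
          k.isLeft = decide (Even s.length) := by
        rintro (_ | ⟨a, _ | ⟨b, c⟩⟩) hc
        · simp only [List.nil_append, List.cons.injEq] at hc
          obtain ⟨rfl, rfl⟩ := hc
          simp
        · simp only [List.cons_append, List.nil_append, List.cons.injEq] at hc
          obtain ⟨-, rfl, rfl⟩ := hc
          simp
        · simp at hc
      rcases List.append_eq_append_iff.mp hu with ⟨a, ha, ha'⟩ | ⟨c, hc, hc'⟩
      · rcases a with _ | ⟨k', a⟩
        · exact hlast [] (by simpa using ha')
        · simp only [List.cons_append, List.cons.injEq] at ha'
          obtain ⟨rfl, rfl⟩ := ha'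
          rw [ih t ⟨u, ha.symm⟩]
          simp [Nat.even_add_one, -Nat.not_even_iff_odd]
      · exact hlast c hc'.symm

variable (dv dc) in
/-- The words leading from the root to the variable nodes and check nodes of the tree. -/
def treeWords (l : ℕ) : Finset (List (Letter dv dc)) :=
  Finset.univ.biUnion fun t : TreeNode dv dc l => (treeWord l t).tails.toFinset

lemma mem_treeWords {l : ℕ} {s : List (Letter dv dc)} :
    s ∈ treeWords dv dc l ↔ ∃ t : TreeNode dv dc l, s <:+ treeWord l t := by
  simp [treeWords]

lemma explorable_treeWords (l : ℕ) : Explorable (treeWords dv dc l) where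
  tail k s h := by
    obtain ⟨t, ht⟩ := mem_treeWords.mp h
    exact mem_treeWords.mpr ⟨t, (List.suffix_cons k s).trans ht⟩
  parity k s h := by
    obtain ⟨t, ht⟩ := mem_treeWords.mp h
    exact parity_of_suffix_treeWord l t ht

lemma unwrap_injective {l : ℕ} {e : Fin n × Fin dv} {G : Graph dv dc n m}
    (h : Simple (treeWords dv dc l) e G) : Function.Injective (unwrap G l e) := by
  intro t t' ht
  have hmem : ∀ t : TreeNode dv dc l, treeWord l t ∈ treeWords dv dc l := fun t =>
    mem_treeWords.mpr ⟨t, List.suffix_rfl⟩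
  apply treeWord_injective l
  apply h (hmem t) (hmem t')
  simp only [node_walk_treeWord, ht]

/-! ### Expectations under the tree assumption -/

/-- The marginal of an i.i.d. family along an injective reindexing is i.i.d. -/
lemma sum_prod_comp_injective {ι κ α R : Type*} [Fintype ι] [Fintype κ] [DecidableEq ι]
    [DecidableEq κ] [Fintype α] [CommSemiring R] {p : α → R} (hp : ∑ a, p a = 1) {τ : ι → κ}
    (hτ : Function.Injective τ) (F : (ι → α) → R) :
    ∑ ω : κ → α, (∏ v, p (ω v)) * F (fun t => ω (τ t)) = ∑ ω : ι → α, (∏ t, p (ω t)) * F ω := by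
  classical
  -- The coordinates outside the range of `τ` integrate to one.
  let f : ι ⊕ ((Set.range τ)ᶜ : Set κ) ≃ κ :=
    (Equiv.sumCongr (Equiv.ofInjective τ hτ) (Equiv.refl _)).trans (Equiv.Set.sumCompl _)
  have hf : ∀ t, f (.inl t) = τ t := fun t => rfl
  have hone : ∑ ω : ((Set.range τ)ᶜ : Set κ) → α, ∏ v, p (ω v) = 1 := by
    have := Finset.prod_univ_sum (fun _ : ((Set.range τ)ᶜ : Set κ) => (Finset.univ : Finset α))
      (fun _ a => p a)
    simp only [hp, Finset.prod_const_one, Fintype.piFinset_univ] at this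
    exact this.symm
  calc ∑ ω : κ → α, (∏ v, p (ω v)) * F (fun t => ω (τ t))
      = ∑ q : (ι → α) × (((Set.range τ)ᶜ : Set κ) → α),
          ((∏ t, p (q.1 t)) * ∏ v, p (q.2 v)) * F q.1 := by
        refine Fintype.sum_equiv
          ((Equiv.arrowCongr f.symm (Equiv.refl α)).trans (Equiv.sumArrowEquivProdArrow _ _ _))
          _ _ fun ω => ?_
        rw [← Fintype.prod_equiv f (fun x => p (ω (f x))) _ fun _ => rfl, Fintype.prod_sum_type]
        rfl
    _ = ∑ ω : ι → α, (∏ t, p (ω t)) * F ω := by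
        rw [Fintype.sum_prod_type]
        refine Finset.sum_congr rfl fun ω _ => ?_
        have : ∀ ω' : ((Set.range τ)ᶜ : Set κ) → α,
            ((∏ t, p (ω t)) * ∏ v, p (ω' v)) * F ω = ((∏ t, p (ω t)) * F ω) * ∏ v, p (ω' v) :=
          fun _ => by ring
        simp only [this]
        rw [← Finset.mul_sum, hone, mul_one]

lemma sum_pmf {α : Type*} [Fintype α] (P : PMF α) : ∑ a, P a = 1 := by
  rw [← tsum_fintype (L := .unconditional _)]
  exact P.tsum_coe

lemma sum_toReal_pmf {α : Type*} [Fintype α] (P : PMF α) : ∑ a, (P a).toReal = 1 := by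
  rw [← ENNReal.toReal_sum fun a _ => P.apply_ne_top a, sum_pmf, ENNReal.toReal_one]

lemma iid_apply {ι α : Type*} [Fintype ι] [DecidableEq ι] [Fintype α] (P : PMF α) (ω : ι → α) :
    iid P ω = ∏ i, P (ω i) := rfl

lemma probX_zero_add_probX_one [Fintype Y] (P : PMF (ZMod 2 × Y)) : probX P 0 + probX P 1 = 1 := by
  have h := sum_pmf P
  rw [Fintype.sum_prod_type] at h
  exact (Fin.sum_univ_two (fun x : ZMod 2 => ∑ y, P (x, y))).symm.trans h

open Classical in
lemma sum_iid_root [Fintype Y] (P : PMF (ZMod 2 × Y)) (l : ℕ) (x : ZMod 2) :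
    ∑ ω : TreeNode dv dc l → ZMod 2 × Y, (if (ω (treeRoot dv dc l)).1 = x then iid P ω else 0)
      = probX P x := by
  have h := sum_prod_comp_injective (κ := TreeNode dv dc l) (sum_pmf P)
    (τ := fun _ : Unit => treeRoot dv dc l) (fun _ _ _ => rfl)
    (fun ω => if (ω ()).1 = x then 1 else 0)
  simp only [mul_ite, mul_one, mul_zero, ← iid_apply] at h
  rw [h, ← (Equiv.funUnique Unit (ZMod 2 × Y)).symm.sum_comp]
  simp only [iid_apply, Fintype.sum_prod_type, probX]
  rw [Finset.sum_eq_single x]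
  · simp
  · intro b _ hb
    simp [hb]
  · simp

-- The form multiplied by `probX P x` also covers a null conditioning event, where both sides
-- vanish.
open Classical in
lemma probX_mul_condMsgLaw [Fintype Y] (P : PMF (ZMod 2 × Y)) (l : ℕ) (x : ZMod 2)
    {A : Set EReal} (hA : MeasurableSet A) :
    probX P x * condMsgLaw P dv dc l x A =
      ∑ ω, if (ω (treeRoot dv dc l)).1 = x ∧ treeMsg P dv dc l ω ∈ A then iid P ω else 0 := by
  let _ : MeasurableSpace (TreeNode dv dc l → ZMod 2 × Y) := ⊤
  have hsum : ∀ S : Set (TreeNode dv dc l → ZMod 2 × Y),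
      (iid P).toMeasure S = ∑ ω, if ω ∈ S then iid P ω else 0 := by
    intro S
    rw [PMF.toMeasure_apply_fintype]
    rfl
  have hroot : (iid P).toMeasure {ω : TreeNode dv dc l → ZMod 2 × Y |
      (ω (treeRoot dv dc l)).1 = x} = probX P x := by
    rw [hsum, ← sum_iid_root (dv := dv) (dc := dc) P l x]
    refine Finset.sum_congr rfl fun ω _ => ?_
    by_cases hx : (ω (treeRoot dv dc l)).1 = x <;> simp [hx]
  have hle : probX P x ≤ 1 := by
    rw [← hroot]
    exact MeasureTheory.prob_le_one
  have hcond : condMsgLaw P dv dc l x A = (probX P x)⁻¹ *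
      ∑ ω, if (ω (treeRoot dv dc l)).1 = x ∧ treeMsg P dv dc l ω ∈ A then iid P ω else 0 := by
    rw [condMsgLaw, MeasureTheory.Measure.map_apply measurable_from_top hA,
      ProbabilityTheory.cond_apply MeasurableSpace.measurableSet_top, hroot, hsum]
    simp only [Set.mem_inter_iff, Set.mem_ofPred_eq, Set.mem_preimage]
  rw [hcond]
  by_cases h0 : probX P x = 0
  · rw [h0, zero_mul]
    symm
    refine le_zero_iff.mp ((Finset.sum_le_sum fun ω _ => ?_).trans
      ((sum_iid_root (dv := dv) (dc := dc) P l x).trans h0).le)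
    by_cases h1 : (ω (treeRoot dv dc l)).1 = x
    · rw [if_pos h1]
      split_ifs
      exacts [le_rfl, zero_le]
    · rw [if_neg h1, if_neg fun h => h1 h.1]
  · rw [← mul_assoc, ENNReal.mul_inv_cancel h0 (ne_top_of_le_ne_top ENNReal.one_ne_top hle),
      one_mul]

-- Reflecting the messages of senders with bit `1` turns the mixture of conditional laws into the
-- unconditional law of `(-1) ^ x` times the message.
open Classical in
lemma avgMsgLaw_real [Fintype Y] (P : PMF (ZMod 2 × Y)) (l : ℕ) {A : Set EReal}
    (hA : MeasurableSet A) :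
    (avgMsgLaw P dv dc l).real A = ∑ ω : TreeNode dv dc l → ZMod 2 × Y, (iid P ω).toReal *
      if flipBy (ω (treeRoot dv dc l)).1 (treeMsg P dv dc l ω) ∈ A then 1 else 0 := by
  have hneg : Measurable fun m : EReal => -m := continuous_neg.measurable
  have h1 : 1 - probX P 0 = probX P 1 :=
    ENNReal.sub_eq_of_eq_add_rev
      (ne_top_of_le_ne_top ENNReal.one_ne_top
        ((self_le_add_right _ _).trans (probX_zero_add_probX_one P).le))
      (probX_zero_add_probX_one P).symm
  have h2 : avgMsgLaw P dv dc l A = ∑ ω : TreeNode dv dc l → ZMod 2 × Y,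
      if flipBy (ω (treeRoot dv dc l)).1 (treeMsg P dv dc l ω) ∈ A then iid P ω else 0 := by
    rw [avgMsgLaw, MeasureTheory.Measure.add_apply, MeasureTheory.Measure.smul_apply,
      MeasureTheory.Measure.smul_apply, MeasureTheory.Measure.map_apply hneg hA, h1, smul_eq_mul,
      smul_eq_mul, probX_mul_condMsgLaw _ _ _ hA, probX_mul_condMsgLaw _ _ _ (hneg hA),
      ← Finset.sum_add_distrib]
    refine Finset.sum_congr rfl fun ω _ => ?_
    have hx : (ω (treeRoot dv dc l)).1 = 0 ∨ (ω (treeRoot dv dc l)).1 = 1 := by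
      generalize (ω (treeRoot dv dc l)).1 = x
      revert x
      decide
    rcases hx with hx | hx <;> simp [hx, flipBy]
  rw [MeasureTheory.measureReal_def, h2, ENNReal.toReal_sum]
  · refine Finset.sum_congr rfl fun ω _ => ?_
    split_ifs <;> simp
  · intro ω _
    split_ifs
    · exact PMF.apply_ne_top _ _
    · exact ENNReal.zero_ne_top

lemma errorProb_eq_sum [Fintype Y] (P : PMF (ZMod 2 × Y)) (l : ℕ) :
    errorProb P dv dc l = ∑ ω : TreeNode dv dc l → ZMod 2 × Y, (∏ t, (P (ω t)).toReal) *
      errorWeight (ω (treeRoot dv dc l)).1 (treeMsg P dv dc l ω) := by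
  rw [errorProb, avgMsgLaw_real _ _ measurableSet_Iio, avgMsgLaw_real _ _ (measurableSet_singleton _),
    Finset.mul_sum, ← Finset.sum_add_distrib]
  refine Finset.sum_congr rfl fun ω _ => ?_
  rw [iid_apply, ENNReal.toReal_prod, errorWeight]
  simp only [Set.mem_Iio, Set.mem_singleton_iff]
  split_ifs with h1 h2 h2
  · rw [h2] at h1
    exact absurd h1 (lt_irrefl _)
  · ring
  · ring
  · ring

/-- The graph is fixed here: distinct tree nodes read distinct source pairs, so the identity is
exact. -/
lemma sum_errorWeight_of_simple [Fintype Y] (P : PMF (ZMod 2 × Y)) {l : ℕ} {e : Fin n × Fin dv}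
    {G : Graph dv dc n m} (h : Simple (treeWords dv dc l) e G) :
    ∑ ω : Fin n → ZMod 2 × Y, (∏ v, (P (ω v)).toReal) *
      errorWeight (ω e.1).1 (varMsg P G ω l e) = errorProb P dv dc l := by
  rw [errorProb_eq_sum, ← sum_prod_comp_injective (sum_toReal_pmf P) (unwrap_injective h)]
  refine Finset.sum_congr rfl fun ω _ => ?_
  simp only [varMsg_eq_treeMsg, unwrap_treeRoot]

lemma errorWeight_nonneg (x : ZMod 2) (msg : EReal) : 0 ≤ errorWeight x msg := by
  unfold errorWeight
  split_ifs <;> norm_num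

lemma errorWeight_le_one (x : ZMod 2) (msg : EReal) : errorWeight x msg ≤ 1 := by
  unfold errorWeight
  split_ifs <;> norm_num

/-! ### Sub-Gaussian functions on finite probability spaces -/

/-- The function `f` on the finite probability space with weights `p` has centred moment generating
function at most `exp (K * t ^ 2)`. -/
def IsSubGaussian {α : Type*} [Fintype α] (p f : α → ℝ) (K : ℝ) : Prop :=
  ∀ t : ℝ, ∑ a, p a * Real.exp (t * (f a - ∑ b, p b * f b)) ≤ Real.exp (K * t ^ 2)

lemma IsSubGaussian.mono {α : Type*} [Fintype α] {p f : α → ℝ} {K K' : ℝ}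
    (h : IsSubGaussian p f K) (hK : K ≤ K') : IsSubGaussian p f K' := fun t =>
  (h t).trans (Real.exp_le_exp.mpr (mul_le_mul_of_nonneg_right hK (sq_nonneg t)))

lemma IsSubGaussian.of_equiv {α β : Type*} [Fintype α] [Fintype β] (e : α ≃ β) {p f : β → ℝ}
    {K : ℝ} (h : IsSubGaussian (fun a => p (e a)) (fun a => f (e a)) K) : IsSubGaussian p f K := by
  intro t
  have h' := h t
  rw [e.sum_comp (fun b => p b * f b)] at h'
  rwa [e.sum_comp (fun b => p b * Real.exp (t * (f b - ∑ b, p b * f b)))] at h'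

lemma isSubGaussian_of_subsingleton {α : Type*} [Fintype α] [Subsingleton α] {p : α → ℝ}
    (hp1 : ∑ a, p a = 1) (f : α → ℝ) : IsSubGaussian p f 0 := by
  intro t
  have hf : ∀ a, f a = ∑ b, p b * f b := by
    intro a
    rw [← one_mul (f a), ← hp1, Finset.sum_mul]
    exact Finset.sum_congr rfl fun b _ => by rw [Subsingleton.elim a b]
  have : ∀ a, p a * Real.exp (t * (f a - ∑ b, p b * f b)) = p a := by
    intro a
    rw [← hf a]
    simp
  simp only [this, hp1]
  simp

/-- Hoeffding's lemma. -/
lemma isSubGaussian_of_abs_sub_le {α : Type*} [Fintype α] {p f : α → ℝ} {c : ℝ} (hc : 0 < c)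
    (hp0 : ∀ a, 0 ≤ p a) (hp1 : ∑ a, p a = 1) (hf : ∀ a b, |f a - f b| ≤ c) :
    IsSubGaussian p f (c ^ 2 / 2) := by
  intro t
  set μ := ∑ b, p b * f b with hμ
  have hdev : ∀ a, |f a - μ| ≤ c := by
    intro a
    have h1 : f a - μ = ∑ b, p b * (f a - f b) := by
      simp only [mul_sub, Finset.sum_sub_distrib]
      rw [← Finset.sum_mul, hp1, one_mul]
    calc |f a - μ| ≤ ∑ b, |p b * (f a - f b)| := by
          rw [h1]
          exact Finset.abs_sum_le_sum_abs _ _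
      _ ≤ ∑ b, p b * c := by
          refine Finset.sum_le_sum fun b _ => ?_
          rw [abs_mul, abs_of_nonneg (hp0 b)]
          exact mul_le_mul_of_nonneg_left (hf a b) (hp0 b)
      _ = c := by rw [← Finset.sum_mul, hp1, one_mul]
  -- Convexity places the exponential below its chord on `[-c, c]`, whose linear term averages to
  -- zero. Using this interval of length `2 * c` about the mean gives `c ^ 2 / 2`.
  have hpt : ∀ a, Real.exp (t * (f a - μ)) ≤
      Real.cosh (t * c) + (f a - μ) / c * Real.sinh (t * c) := by
    intro a
    have h1 : |(f a - μ) / c| ≤ 1 := by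
      rw [abs_div, abs_of_pos hc, div_le_one hc]
      exact hdev a
    have h2 := Real.exp_mul_le_cosh_add_mul_sinh h1 (t * c)
    have h3 : (f a - μ) / c * (t * c) = t * (f a - μ) := by field_simp
    rwa [h3] at h2
  calc ∑ a, p a * Real.exp (t * (f a - μ))
      ≤ ∑ a, p a * (Real.cosh (t * c) + (f a - μ) / c * Real.sinh (t * c)) :=
        Finset.sum_le_sum fun a _ => mul_le_mul_of_nonneg_left (hpt a) (hp0 a)
    _ = (∑ a, p a) * Real.cosh (t * c) +
        ((∑ a, p a * f a) - (∑ a, p a) * μ) * (Real.sinh (t * c) / c) := by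
        rw [Finset.sum_mul, Finset.sum_mul, ← Finset.sum_sub_distrib, Finset.sum_mul,
          ← Finset.sum_add_distrib]
        refine Finset.sum_congr rfl fun a _ => ?_
        ring
    _ = Real.cosh (t * c) := by rw [hp1, ← hμ]; ring
    _ ≤ Real.exp ((t * c) ^ 2 / 2) := Real.cosh_le_exp_half_sq _
    _ = Real.exp (c ^ 2 / 2 * t ^ 2) := by congr 1; ring

/-- This is one martingale step: the deviation is that of the conditional mean given `a` plus the
deviation inside the fibre over `a`, so the constants add. -/
lemma IsSubGaussian.prod {α β : Type*} [Fintype α] [Fintype β] {p : α → ℝ} {q : β → ℝ}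
    {f : α × β → ℝ} {K₁ K₂ : ℝ} (hp0 : ∀ a, 0 ≤ p a)
    (h₁ : IsSubGaussian p (fun a => ∑ b, q b * f (a, b)) K₁)
    (h₂ : ∀ a, IsSubGaussian q (fun b => f (a, b)) K₂) :
    IsSubGaussian (fun x : α × β => p x.1 * q x.2) f (K₁ + K₂) := by
  intro t
  have hμ : ∑ x : α × β, p x.1 * q x.2 * f x = ∑ a, p a * ∑ b, q b * f (a, b) := by
    rw [Fintype.sum_prod_type]
    refine Finset.sum_congr rfl fun a _ => ?_
    rw [Finset.mul_sum]
    exact Finset.sum_congr rfl fun b _ => by ring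
  rw [hμ, Fintype.sum_prod_type]
  have h₁' := h₁ t
  set μ := ∑ a, p a * ∑ b, q b * f (a, b)
  calc ∑ a, ∑ b, p a * q b * Real.exp (t * (f (a, b) - μ))
      = ∑ a, p a * Real.exp (t * ((∑ b, q b * f (a, b)) - μ)) *
          ∑ b, q b * Real.exp (t * (f (a, b) - ∑ b, q b * f (a, b))) := by
        refine Finset.sum_congr rfl fun a _ => ?_
        rw [Finset.mul_sum]
        refine Finset.sum_congr rfl fun b _ => ?_
        have : t * (f (a, b) - μ) = t * ((∑ b, q b * f (a, b)) - μ) +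
          t * (f (a, b) - ∑ b, q b * f (a, b)) := by ring
        rw [this, Real.exp_add]
        ring
    _ ≤ ∑ a, p a * Real.exp (t * ((∑ b, q b * f (a, b)) - μ)) * Real.exp (K₂ * t ^ 2) :=
        Finset.sum_le_sum fun a _ => mul_le_mul_of_nonneg_left (h₂ a t)
          (mul_nonneg (hp0 a) (Real.exp_pos _).le)
    _ ≤ Real.exp (K₁ * t ^ 2) * Real.exp (K₂ * t ^ 2) := by
        rw [← Finset.sum_mul]
        exact mul_le_mul_of_nonneg_right h₁' (Real.exp_pos _).le
    _ = _ := by rw [← Real.exp_add]; congr 1; ring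

lemma abs_sum_mul_sub_sum_mul_le {α : Type*} [Fintype α] {p f g : α → ℝ} {c : ℝ}
    (hp0 : ∀ a, 0 ≤ p a) (hp1 : ∑ a, p a = 1) (h : ∀ a, |f a - g a| ≤ c) :
    |(∑ a, p a * f a) - ∑ a, p a * g a| ≤ c := by
  rw [← Finset.sum_sub_distrib]
  calc |∑ a, (p a * f a - p a * g a)| ≤ ∑ a, |p a * f a - p a * g a| :=
        Finset.abs_sum_le_sum_abs _ _
    _ ≤ ∑ a, p a * c := by
        refine Finset.sum_le_sum fun a _ => ?_
        rw [← mul_sub, abs_mul, abs_of_nonneg (hp0 a)]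
        exact mul_le_mul_of_nonneg_left (h a) (hp0 a)
    _ = c := by rw [← Finset.sum_mul, hp1, one_mul]

lemma sum_prod_eq_one {ι α : Type*} [Fintype ι] [DecidableEq ι] [Fintype α] {p : α → ℝ}
    (hp1 : ∑ a, p a = 1) : ∑ ω : ι → α, ∏ i, p (ω i) = 1 := by
  have := Finset.prod_univ_sum (fun _ : ι => (Finset.univ : Finset α)) (fun _ a => p a)
  simp only [hp1, Finset.prod_const_one, Fintype.piFinset_univ] at this
  exact this.symm

/-- The bounded difference inequality for i.i.d. families. -/
lemma isSubGaussian_pi {α : Type*} [Fintype α] {p : α → ℝ} {c : ℝ} (hc : 0 < c)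
    (hp0 : ∀ a, 0 ≤ p a) (hp1 : ∑ a, p a = 1) (n : ℕ) (f : (Fin n → α) → ℝ)
    (hf : ∀ ω i a, |f (Function.update ω i a) - f ω| ≤ c) :
    IsSubGaussian (fun ω : Fin n → α => ∏ i, p (ω i)) f (n * (c ^ 2 / 2)) := by
  induction n with
  | zero =>
    rw [Nat.cast_zero, zero_mul]
    exact isSubGaussian_of_subsingleton (sum_prod_eq_one hp1) f
  | succ n ih =>
    have hpos : ∀ ω : Fin n → α, 0 ≤ ∏ i, p (ω i) := fun ω =>
      Finset.prod_nonneg fun i _ => hp0 _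
    have key := IsSubGaussian.prod (p := p) (q := fun ω : Fin n → α => ∏ i, p (ω i))
      (f := fun x : α × (Fin n → α) => f (Fin.cons x.1 x.2)) (K₁ := c ^ 2 / 2)
      (K₂ := n * (c ^ 2 / 2)) hp0 ?_ ?_
    · refine IsSubGaussian.of_equiv (Fin.consEquiv fun _ => α) ?_
      refine IsSubGaussian.mono (K := c ^ 2 / 2 + n * (c ^ 2 / 2)) ?_ (by push_cast; linarith)
      convert key using 2 with x
      · rw [Fin.prod_univ_succ]
        rfl
      · rfl
    · refine isSubGaussian_of_abs_sub_le hc hp0 hp1 fun a b => ?_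
      refine abs_sum_mul_sub_sum_mul_le hpos (sum_prod_eq_one hp1) fun ω => ?_
      have := hf (Fin.cons b ω) 0 a
      rwa [Fin.update_cons_zero] at this
    · intro a
      refine ih _ fun ω i b => ?_
      have := hf (Fin.cons a ω) i.succ b
      rwa [← Fin.cons_update] at this

/-! ### Bounded differences on the symmetric group -/

lemma decomposeFin_symm_mul_swap {n : ℕ} (k : Fin (n + 1)) (σ : Equiv.Perm (Fin n)) (x y : Fin n) :
    Equiv.Perm.decomposeFin.symm (k, σ * Equiv.swap x y) =
      Equiv.Perm.decomposeFin.symm (k, σ) * Equiv.swap x.succ y.succ := by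
  ext z
  refine Fin.cases ?_ (fun z => ?_) z
  · rw [Equiv.Perm.mul_apply, Equiv.swap_apply_of_ne_of_ne (Fin.succ_ne_zero _).symm
      (Fin.succ_ne_zero _).symm]
    simp
  · rw [Equiv.Perm.mul_apply, ← (Fin.succ_injective n).map_swap]
    simp

/-- Permutations with different images of `0` are coupled through the same remainder `σ`, so that
changing the image to or from `0` costs one transposition. -/
lemma decomposeFin_symm_eq_mul {n : ℕ} (k : Fin (n + 1)) (σ : Equiv.Perm (Fin n)) :
    Equiv.Perm.decomposeFin.symm (k, σ) =
      Equiv.swap 0 k * Equiv.Perm.decomposeFin.symm (0, σ) := by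
  ext z
  refine Fin.cases ?_ (fun z => ?_) z <;> simp

/-- The bounded difference inequality for uniformly random permutations. -/
lemma isSubGaussian_perm {c : ℝ} (hc : 0 < c) (n : ℕ) (f : Equiv.Perm (Fin n) → ℝ)
    (hf : ∀ σ x y, |f (σ * Equiv.swap x y) - f σ| ≤ c) :
    IsSubGaussian (fun _ : Equiv.Perm (Fin n) => (Fintype.card (Equiv.Perm (Fin n)) : ℝ)⁻¹) f
      (n * (2 * c ^ 2)) := by
  induction n with
  | zero =>
    rw [Nat.cast_zero, zero_mul]
    exact isSubGaussian_of_subsingleton (by simp) f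
  | succ n ih =>
    have hunif : ∀ (γ : Type) [Fintype γ] [Nonempty γ], ∑ _ : γ, (Fintype.card γ : ℝ)⁻¹ = 1 := by
      intro γ _ _
      simp
    have key := IsSubGaussian.prod (p := fun _ : Fin (n + 1) => (Fintype.card (Fin (n + 1)) : ℝ)⁻¹)
      (q := fun _ : Equiv.Perm (Fin n) => (Fintype.card (Equiv.Perm (Fin n)) : ℝ)⁻¹)
      (f := fun x => f (Equiv.Perm.decomposeFin.symm x)) (K₁ := (2 * c) ^ 2 / 2)
      (K₂ := n * (2 * c ^ 2)) (fun _ => by positivity) ?_ ?_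
    · refine IsSubGaussian.of_equiv Equiv.Perm.decomposeFin.symm ?_
      refine IsSubGaussian.mono (K := (2 * c) ^ 2 / 2 + n * (2 * c ^ 2)) ?_
        (by push_cast; linarith)
      convert key using 2 with x
      rw [Fintype.card_congr Equiv.Perm.decomposeFin, Fintype.card_prod, Nat.cast_mul, mul_inv]
    · refine isSubGaussian_of_abs_sub_le (by linarith) (fun _ => by positivity) (hunif _)
        fun a b => ?_
      refine abs_sum_mul_sub_sum_mul_le (fun _ => by positivity) (hunif _) fun σ => ?_
      -- Comparing both images with `0` costs `c` each; the increment `2 * c` yields `(2 * c) ^ 2 /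
      -- 2 = 2 * c ^ 2` per revealed value.
      have h : ∀ k : Fin (n + 1), |f (Equiv.Perm.decomposeFin.symm (k, σ)) -
          f (Equiv.Perm.decomposeFin.symm (0, σ))| ≤ c := by
        intro k
        rw [decomposeFin_symm_eq_mul, Equiv.swap_mul_eq_mul_swap]
        exact hf _ _ _
      have ha := h a
      have hb := h b
      rw [abs_le] at ha hb ⊢
      constructor <;> linarith
    · intro k
      refine ih _ fun σ x y => ?_
      rw [decomposeFin_symm_mul_swap]
      exact hf _ _ _

open Classical in
lemma IsSubGaussian.tail_le {α : Type*} [Fintype α] {p f : α → ℝ} {K δ : ℝ}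
    (h : IsSubGaussian p f K) (hp0 : ∀ a, 0 ≤ p a) (hK : 0 < K) (hδ : 0 ≤ δ) :
    ∑ a, p a * (if δ < |f a - ∑ b, p b * f b| then 1 else 0) ≤
      2 * Real.exp (-(δ ^ 2 / (4 * K))) := by
  set μ := ∑ b, p b * f b
  -- This value minimises the Chernoff exponent `K * t ^ 2 - t * δ`.
  set t := δ / (2 * K) with ht
  have ht0 : 0 ≤ t := by positivity
  have hpt : ∀ a, (if δ < |f a - μ| then (1 : ℝ) else 0) ≤
      Real.exp (-(t * δ)) * (Real.exp (t * (f a - μ)) + Real.exp (-t * (f a - μ))) := by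
    intro a
    split_ifs with ha
    · rw [mul_add, ← Real.exp_add, ← Real.exp_add]
      have h1 := Real.exp_pos (-(t * δ) + t * (f a - μ))
      have h2 := Real.exp_pos (-(t * δ) + -t * (f a - μ))
      rcases lt_abs.mp ha with h3 | h3
      · have h4 : 0 ≤ -(t * δ) + t * (f a - μ) := by nlinarith
        have := Real.one_le_exp h4
        linarith
      · have h4 : 0 ≤ -(t * δ) + -t * (f a - μ) := by nlinarith
        have := Real.one_le_exp h4
        linarith
    · positivity
  calc ∑ a, p a * (if δ < |f a - μ| then 1 else 0)
      ≤ ∑ a, p a * (Real.exp (-(t * δ)) *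
          (Real.exp (t * (f a - μ)) + Real.exp (-t * (f a - μ)))) :=
        Finset.sum_le_sum fun a _ => mul_le_mul_of_nonneg_left (hpt a) (hp0 a)
    _ = Real.exp (-(t * δ)) * (∑ a, p a * Real.exp (t * (f a - μ)) +
          ∑ a, p a * Real.exp (-t * (f a - μ))) := by
        rw [← Finset.sum_add_distrib, Finset.mul_sum]
        exact Finset.sum_congr rfl fun a _ => by ring
    _ ≤ Real.exp (-(t * δ)) * (Real.exp (K * t ^ 2) + Real.exp (K * (-t) ^ 2)) :=
        mul_le_mul_of_nonneg_left (add_le_add (h t) (h (-t))) (Real.exp_pos _).le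
    _ = 2 * Real.exp (-(t * δ) + K * t ^ 2) := by
        rw [neg_sq, Real.exp_add]
        ring
    _ = _ := by
        congr 2
        rw [ht]
        field_simp
        ring

/-! ### Concentration of the number of incorrect messages -/

/-- Numbering the sockets on both sides turns graphs into permutations, and right multiplication by
a transposition into a switching of variable sockets. -/
lemma isSubGaussian_graph (h : n * dv = m * dc) {c : ℝ} (hc : 0 < c) (f : Graph dv dc n m → ℝ)
    (hf : ∀ G x y, |f (switch G (.inl x) (.inl y)) - f G| ≤ c) :
    IsSubGaussian (fun _ => (Fintype.card (Graph dv dc n m) : ℝ)⁻¹) f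
      ((n * dv : ℕ) * (2 * c ^ 2)) := by
  let eV : Fin n × Fin dv ≃ Fin (n * dv) := Fintype.equivOfCardEq (by simp)
  let eC : Fin m × Fin dc ≃ Fin (n * dv) := Fintype.equivOfCardEq (by simp [h])
  let φ : Graph dv dc n m ≃ Equiv.Perm (Fin (n * dv)) := Equiv.equivCongr eV eC
  refine IsSubGaussian.of_equiv φ.symm ?_
  rw [Fintype.card_congr φ]
  refine isSubGaussian_perm hc _ _ fun σ x y => ?_
  have : φ.symm (σ * Equiv.swap x y) =
      switch (φ.symm σ) (.inl (eV.symm x)) (.inl (eV.symm y)) := by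
    ext e : 1
    simp only [φ, switch, Equiv.equivCongr_symm, Equiv.equivCongr_apply_apply, Equiv.symm_symm,
      Equiv.trans_apply, Equiv.Perm.mul_apply]
    rw [eV.injective.map_swap]
    simp
  rw [this]
  exact hf _ _ _

open Classical in
/-- Sums of numbers from `[0, 1]` differ by at most the number of terms that change. -/
lemma abs_sum_sub_sum_le {ι : Type*} [Fintype ι] {f g : ι → ℝ} (hf0 : ∀ i, 0 ≤ f i)
    (hf1 : ∀ i, f i ≤ 1) (hg0 : ∀ i, 0 ≤ g i) (hg1 : ∀ i, g i ≤ 1) {S : Finset ι}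
    (h : ∀ i ∉ S, f i = g i) : |∑ i, f i - ∑ i, g i| ≤ S.card := by
  rw [← Finset.sum_sub_distrib, ← Finset.sum_subset (Finset.subset_univ S)]
  · calc |∑ i ∈ S, (f i - g i)| ≤ ∑ i ∈ S, |f i - g i| := Finset.abs_sum_le_sum_abs _ _
      _ ≤ ∑ i ∈ S, (1 : ℝ) := by
          refine Finset.sum_le_sum fun i _ => ?_
          have h0 := hf0 i
          have h1 := hf1 i
          have h2 := hg0 i
          have h3 := hg1 i
          rw [abs_le]
          constructor <;> linarith
      _ = S.card := by simp
  · intro i _ hi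
    rw [h i hi, sub_self]

-- Each tree node is reached by a word of length at most `2 * l`, and each letter spoils at most
-- four starting points.
open Classical in
lemma card_unwrap_switch_ne_le (G : Graph dv dc n m) (x y : Fin n × Fin dv) (l : ℕ) :
    (Finset.univ.filter fun e => unwrap (switch G (.inl x) (.inl y)) l e ≠ unwrap G l e).card
      ≤ Fintype.card (TreeNode dv dc l) * (8 * l) := by
  refine (Finset.card_le_card (t := Finset.univ.biUnion fun t : TreeNode dv dc l =>
    Finset.univ.filter fun e => walk (switch G (.inl x) (.inl y)) (treeWord l t) (.inl e) ≠
      walk G (treeWord l t) (.inl e)) ?_).trans ?_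
  · intro e he
    replace he := (Finset.mem_filter.mp he).2
    obtain ⟨t, ht⟩ := Function.ne_iff.mp he
    refine Finset.mem_biUnion.mpr ⟨t, Finset.mem_univ _,
      Finset.mem_filter.mpr ⟨Finset.mem_univ _, fun hw => ht ?_⟩⟩
    have := congrArg node hw
    rwa [node_walk_treeWord, node_walk_treeWord, Sum.inl.injEq] at this
  · refine Finset.card_biUnion_le_card_mul _ _ _ fun t _ => ?_
    have h1 := card_walk_switch_ne_le G (a := .inl x) (b := .inl y) rfl (treeWord l t)
    have h2 := length_treeWord_le l t
    refine le_trans ?_ (h1.trans (by omega))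
    refine Finset.card_le_card_of_injOn Sum.inl ?_ Sum.inl_injective.injOn
    intro e he
    have := (Finset.mem_filter.mp he).2
    exact Finset.mem_filter.mpr ⟨Finset.mem_univ _, this⟩

open Classical in
lemma card_mem_range_unwrap_le (G : Graph dv dc n m) (l : ℕ) (v : Fin n) :
    (Finset.univ.filter fun e => ∃ t, unwrap G l e t = v).card
      ≤ Fintype.card (TreeNode dv dc l) * (dv + dc) := by
  refine (Finset.card_le_card (t := Finset.univ.biUnion fun t : TreeNode dv dc l =>
    Finset.univ.filter fun e => node (walk G (treeWord l t) (.inl e)) = .inl v) ?_).trans ?_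
  · intro e he
    obtain ⟨t, ht⟩ := (Finset.mem_filter.mp he).2
    refine Finset.mem_biUnion.mpr ⟨t, Finset.mem_univ _,
      Finset.mem_filter.mpr ⟨Finset.mem_univ _, ?_⟩⟩
    rw [node_walk_treeWord, ht]
  · refine Finset.card_biUnion_le_card_mul _ _ _ fun t _ => ?_
    refine le_trans ?_ (card_node_walk_eq_le G (treeWord l t) (.inl v))
    refine Finset.card_le_card_of_injOn Sum.inl ?_ Sum.inl_injective.injOn
    intro e he
    have := (Finset.mem_filter.mp he).2
    exact Finset.mem_filter.mpr ⟨Finset.mem_univ _, this⟩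

lemma abs_numIncorrect_switch_sub_le (P : PMF (ZMod 2 × Y)) (l : ℕ) (G : Graph dv dc n m)
    (x y : Fin n × Fin dv) (ω : Fin n → ZMod 2 × Y) :
    |numIncorrect P l (switch G (.inl x) (.inl y)) ω - numIncorrect P l G ω|
      ≤ (Fintype.card (TreeNode dv dc l) * (8 * l) : ℕ) := by
  classical
  refine (abs_sum_sub_sum_le (fun _ => errorWeight_nonneg _ _) (fun _ => errorWeight_le_one _ _)
    (fun _ => errorWeight_nonneg _ _) (fun _ => errorWeight_le_one _ _) fun e he => ?_).trans
    (Nat.cast_le.mpr (card_unwrap_switch_ne_le G x y l))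
  have h : unwrap (switch G (.inl x) (.inl y)) l e = unwrap G l e := by
    by_contra h
    exact he (Finset.mem_filter.mpr ⟨Finset.mem_univ _, h⟩)
  rw [varMsg_eq_treeMsg, varMsg_eq_treeMsg, h]

lemma abs_numIncorrect_update_sub_le (P : PMF (ZMod 2 × Y)) (l : ℕ) (G : Graph dv dc n m)
    (ω : Fin n → ZMod 2 × Y) (v : Fin n) (a : ZMod 2 × Y) :
    |numIncorrect P l G (Function.update ω v a) - numIncorrect P l G ω|
      ≤ (Fintype.card (TreeNode dv dc l) * (dv + dc) : ℕ) := by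
  classical
  refine (abs_sum_sub_sum_le (fun _ => errorWeight_nonneg _ _) (fun _ => errorWeight_le_one _ _)
    (fun _ => errorWeight_nonneg _ _) (fun _ => errorWeight_le_one _ _) fun e he => ?_).trans
    (Nat.cast_le.mpr (card_mem_range_unwrap_le G l v))
  have h : ∀ t, Function.update ω v a (unwrap G l e t) = ω (unwrap G l e t) := fun t =>
    Function.update_of_ne (fun ht => he (Finset.mem_filter.mpr ⟨Finset.mem_univ _, t, ht⟩)) _ _
  rw [varMsg_eq_treeMsg, varMsg_eq_treeMsg, ← unwrap_treeRoot G l e]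
  simp only [h]

lemma isSubGaussian_numIncorrect [Fintype Y] (P : PMF (ZMod 2 × Y)) (l : ℕ)
    (h : n * dv = m * dc) :
    IsSubGaussian
      (fun w : Graph dv dc n m × (Fin n → ZMod 2 × Y) =>
        (Fintype.card (Graph dv dc n m) : ℝ)⁻¹ * ∏ v, (P (w.2 v)).toReal)
      (fun w => numIncorrect P l w.1 w.2)
      (n * (2 * dv * (Fintype.card (TreeNode dv dc l) * (8 * l) + 1) ^ 2 +
        (Fintype.card (TreeNode dv dc l) * (dv + dc) + 1) ^ 2 / 2)) := by
  have hp0 : ∀ a, 0 ≤ (P a).toReal := fun _ => ENNReal.toReal_nonneg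
  refine IsSubGaussian.mono (IsSubGaussian.prod
    (f := fun w : Graph dv dc n m × (Fin n → ZMod 2 × Y) => numIncorrect P l w.1 w.2)
    (q := fun ω : Fin n → ZMod 2 × Y => ∏ v, (P (ω v)).toReal)
    (fun _ => by positivity)
    -- The summand `1` in both difference bounds keeps them positive even when the counts vanish.
    (isSubGaussian_graph h
      (c := Fintype.card (TreeNode dv dc l) * (8 * l) + 1) (by positivity) _ fun G x y => ?_)
    (fun G => isSubGaussian_pi (c := Fintype.card (TreeNode dv dc l) * (dv + dc) + 1)
      (by positivity) hp0 (sum_toReal_pmf P) n _ fun ω v a => ?_)) ?_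
  · refine abs_sum_mul_sub_sum_mul_le (fun ω => Finset.prod_nonneg fun _ _ => hp0 _)
      (sum_prod_eq_one (sum_toReal_pmf P)) fun ω => ?_
    refine (abs_numIncorrect_switch_sub_le P l G x y ω).trans ?_
    push_cast
    linarith
  · refine (abs_numIncorrect_update_sub_le P l G ω v a).trans ?_
    push_cast
    linarith
  · push_cast
    apply le_of_eq
    ring

/-! ### The mean compared with its value on the tree -/

lemma errorProb_mem_Icc [Fintype Y] (P : PMF (ZMod 2 × Y)) (l : ℕ) :
    0 ≤ errorProb P dv dc l ∧ errorProb P dv dc l ≤ 1 := by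
  have hp0 : ∀ ω : TreeNode dv dc l → ZMod 2 × Y, 0 ≤ ∏ t, (P (ω t)).toReal := fun ω =>
    Finset.prod_nonneg fun _ _ => ENNReal.toReal_nonneg
  rw [errorProb_eq_sum]
  refine ⟨Finset.sum_nonneg fun ω _ => mul_nonneg (hp0 ω) (errorWeight_nonneg _ _), ?_⟩
  rw [← sum_prod_eq_one (ι := TreeNode dv dc l) (sum_toReal_pmf P)]
  exact Finset.sum_le_sum fun ω _ => mul_le_of_le_one_right (hp0 ω) (errorWeight_le_one _ _)

open Classical in
lemma abs_sum_numIncorrect_sub_le [Fintype Y] (P : PMF (ZMod 2 × Y)) (l : ℕ)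
    (G : Graph dv dc n m) :
    |∑ ω, (∏ v, (P (ω v)).toReal) * numIncorrect P l G ω - n * dv * errorProb P dv dc l| ≤
      ∑ e, if Simple (treeWords dv dc l) e G then 0 else 1 := by
  have h1 : ∑ ω, (∏ v, (P (ω v)).toReal) * numIncorrect P l G ω -
      n * dv * errorProb P dv dc l =
      ∑ e : Fin n × Fin dv, (∑ ω : Fin n → ZMod 2 × Y, (∏ v, (P (ω v)).toReal) *
        errorWeight (ω e.1).1 (varMsg P G ω l e) - errorProb P dv dc l) := by
    rw [Finset.sum_sub_distrib, Finset.sum_comm]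
    congr 1
    · exact Finset.sum_congr rfl fun ω _ => by rw [numIncorrect, Finset.mul_sum]
    · simp
  rw [h1]
  refine (Finset.abs_sum_le_sum_abs _ _).trans (Finset.sum_le_sum fun e _ => ?_)
  split_ifs with hs
  · rw [sum_errorWeight_of_simple P hs, sub_self, abs_zero]
  · have hp0 : ∀ ω : Fin n → ZMod 2 × Y, 0 ≤ ∏ v, (P (ω v)).toReal := fun ω =>
      Finset.prod_nonneg fun _ _ => ENNReal.toReal_nonneg
    have h2 : 0 ≤ ∑ ω : Fin n → ZMod 2 × Y, (∏ v, (P (ω v)).toReal) *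
        errorWeight (ω e.1).1 (varMsg P G ω l e) :=
      Finset.sum_nonneg fun ω _ => mul_nonneg (hp0 ω) (errorWeight_nonneg _ _)
    have h3 : ∑ ω : Fin n → ZMod 2 × Y, (∏ v, (P (ω v)).toReal) *
        errorWeight (ω e.1).1 (varMsg P G ω l e) ≤ 1 := by
      rw [← sum_prod_eq_one (ι := Fin n) (sum_toReal_pmf P)]
      exact Finset.sum_le_sum fun ω _ => mul_le_of_le_one_right (hp0 ω) (errorWeight_le_one _ _)
    obtain ⟨h4, h5⟩ := errorProb_mem_Icc (dv := dv) (dc := dc) P l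
    rw [abs_le]
    constructor <;> linarith

/-- The expected number of incorrect messages is within a constant of its value under the tree
assumption. -/
lemma abs_mean_sub_le [Fintype Y] (P : PMF (ZMod 2 × Y)) (l : ℕ) (h : n * dv = m * dc)
    (hpos : 0 < n * dv) :
    |∑ w : Graph dv dc n m × (Fin n → ZMod 2 × Y),
        (Fintype.card (Graph dv dc n m) : ℝ)⁻¹ * (∏ v, (P (w.2 v)).toReal) *
          numIncorrect P l w.1 w.2 - n * dv * errorProb P dv dc l| ≤
      ((treeWords dv dc l).card ^ 2 * (dv + dc) + 2 * (treeWords dv dc l).card : ℕ) := by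
  classical
  have hne : Nonempty (Graph dv dc n m) := ⟨Fintype.equivOfCardEq (by simpa using h)⟩
  set g : ℝ := (Fintype.card (Graph dv dc n m) : ℝ) with hg
  have hg0 : 0 < g := by
    rw [hg]
    exact_mod_cast Fintype.card_pos
  set C := (treeWords dv dc l).card ^ 2 * (dv + dc) + 2 * (treeWords dv dc l).card
  have hsplit : ∑ w : Graph dv dc n m × (Fin n → ZMod 2 × Y),
        g⁻¹ * (∏ v, (P (w.2 v)).toReal) * numIncorrect P l w.1 w.2 =
      ∑ G : Graph dv dc n m, g⁻¹ * ∑ ω, (∏ v, (P (ω v)).toReal) * numIncorrect P l G ω := by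
    rw [Fintype.sum_prod_type]
    refine Finset.sum_congr rfl fun G _ => ?_
    rw [Finset.mul_sum]
    exact Finset.sum_congr rfl fun ω _ => by ring
  have hconst : (n : ℝ) * dv * errorProb P dv dc l =
      ∑ _G : Graph dv dc n m, g⁻¹ * (n * dv * errorProb P dv dc l) := by
    rw [Finset.sum_const, Finset.card_univ, nsmul_eq_mul, ← hg, mul_inv_cancel_left₀ hg0.ne']
  have hN : (0 : ℝ) < ((n * dv : ℕ) : ℝ) := by exact_mod_cast hpos
  -- Each edge is bad in at most a fraction `C / (n * dv)` of the graphs, so the expected number of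
  -- bad edges is at most `C`.
  have hcol : ∀ e : Fin n × Fin dv, ∑ G : Graph dv dc n m,
      (if Simple (treeWords dv dc l) e G then (0 : ℝ) else 1) ≤ C * g / (n * dv : ℕ) := by
    intro e
    have h1 := card_mul_card_not_simple_le h e (explorable_treeWords (dv := dv) (dc := dc) l)
    rw [le_div_iff₀ hN, hg]
    calc _ = ((n * dv : ℕ) : ℝ) * ((Finset.univ.filter fun G : Graph dv dc n m =>
          ¬ Simple (treeWords dv dc l) e G).card : ℝ) := by
          rw [mul_comm]
          congr 1
          rw [Finset.card_filter, Nat.cast_sum]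
          refine Finset.sum_congr rfl fun G _ => ?_
          split_ifs <;> simp
      _ ≤ _ := by exact_mod_cast h1
  rw [hsplit, hconst, ← Finset.sum_sub_distrib]
  calc _ ≤ ∑ G : Graph dv dc n m, g⁻¹ *
          ∑ e : Fin n × Fin dv, (if Simple (treeWords dv dc l) e G then (0 : ℝ) else 1) := by
        refine (Finset.abs_sum_le_sum_abs _ _).trans (Finset.sum_le_sum fun G _ => ?_)
        rw [← mul_sub, abs_mul, abs_of_pos (inv_pos.mpr hg0)]
        exact mul_le_mul_of_nonneg_left (abs_sum_numIncorrect_sub_le P l G) (inv_pos.mpr hg0).le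
    _ = g⁻¹ * ∑ e : Fin n × Fin dv, ∑ G : Graph dv dc n m,
          (if Simple (treeWords dv dc l) e G then (0 : ℝ) else 1) := by
        rw [← Finset.mul_sum, Finset.sum_comm]
    _ ≤ g⁻¹ * ∑ _e : Fin n × Fin dv, (C * g / (n * dv : ℕ) : ℝ) :=
        mul_le_mul_of_nonneg_left (Finset.sum_le_sum fun e _ => hcol e) (inv_pos.mpr hg0).le
    _ = C := by
        rw [Finset.sum_const, Finset.card_univ, Fintype.card_prod, Fintype.card_fin,
          Fintype.card_fin, nsmul_eq_mul, mul_div_cancel₀ _ hN.ne']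
        field_simp

open Classical in
lemma jointLaw_toReal [Fintype Y] (P : PMF (ZMod 2 × Y)) (h : n * dv = m * dc)
    (S : Set (Graph dv dc n m × (Fin n → ZMod 2 × Y))) :
    ((jointLaw P h).toOuterMeasure S).toReal =
      ∑ w : Graph dv dc n m × (Fin n → ZMod 2 × Y),
        (Fintype.card (Graph dv dc n m) : ℝ)⁻¹ * (∏ v, (P (w.2 v)).toReal) *
          (if w ∈ S then 1 else 0) := by
  have happ : ∀ w : Graph dv dc n m × (Fin n → ZMod 2 × Y), jointLaw P h w =
      (Fintype.card (Graph dv dc n m) : ℝ≥0∞)⁻¹ * ∏ v, P (w.2 v) := by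
    rintro ⟨G, ω⟩
    rw [jointLaw, PMF.bind_apply, tsum_eq_single G]
    · rw [PMF.map_apply, tsum_eq_single ω]
      · simp [ensemble, iid_apply]
      · intro ω' hω
        simp [hω.symm]
    · intro G' hG
      rw [PMF.map_apply]
      simp [hG.symm]
  rw [PMF.toOuterMeasure_apply_fintype, ENNReal.toReal_sum]
  · refine Finset.sum_congr rfl fun w _ => ?_
    by_cases hw : w ∈ S
    · simp [hw, happ, ENNReal.toReal_prod]
    · simp [hw]
  · intro w _
    by_cases hw : w ∈ S
    · simpa [hw] using PMF.apply_ne_top _ _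
    · simp [hw]

end SlepianWolf

end

theorem theorem4 (dv dc l : ℕ) :
    ∃ β : ℝ, 0 < β ∧ ∃ γ : ℝ, 0 < γ ∧
      ∀ (Y : Type u) [Fintype Y] (P : PMF (ZMod 2 × Y)) (n m : ℕ) (h : n * dv = m * dc) (ε : ℝ),
        0 < ε → 2 * γ / ε < (n : ℝ) →
        ((SlepianWolf.jointLaw P h).toOuterMeasure
            {w | (n : ℝ) * dv * ε <
              |SlepianWolf.numIncorrect P l w.1 w.2
                - (n : ℝ) * dv * SlepianWolf.errorProb P dv dc l|}).toReal
          ≤ 2 * Real.exp (-β * ε ^ 2 * n) := by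
  classical
  rcases Nat.eq_zero_or_pos dv with rfl | hdv
  -- Without edges the event reads `0 < 0`.
  · refine ⟨1, one_pos, 1, one_pos, fun Y _ P n m h ε _ _ => ?_⟩
    rw [SlepianWolf.jointLaw_toReal, Finset.sum_eq_zero]
    · positivity
    · intro w _
      simp [SlepianWolf.numIncorrect]
  have hdv' : (0 : ℝ) < dv := by exact_mod_cast hdv
  let κ : ℝ := 2 * dv * (Fintype.card (SlepianWolf.TreeNode dv dc l) * (8 * l) + 1) ^ 2 +
    (Fintype.card (SlepianWolf.TreeNode dv dc l) * (dv + dc) + 1) ^ 2 / 2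
  have hκ : 0 < κ := by positivity
  let C : ℕ := (SlepianWolf.treeWords dv dc l).card ^ 2 * (dv + dc) +
    2 * (SlepianWolf.treeWords dv dc l).card
  -- The tail bound at `δ = n * dv * ε / 2` with variance constant `n * κ` has exponent `δ ^ 2 / (4
  -- * n * κ) = dv ^ 2 * ε ^ 2 * n / (16 * κ)`. The other half of the deviation absorbs the bias
  -- `C`, since `n * ε > 2 * (C + 1)` and `dv ≥ 1`.
  refine ⟨dv ^ 2 / (16 * κ), by positivity, C + 1, by positivity, fun Y _ P n m h ε hε hn => ?_⟩
  rw [div_lt_iff₀ hε] at hn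
  have hn0 : 0 < (n : ℝ) := by
    by_contra hle
    have : (n : ℝ) * ε ≤ 0 := mul_nonpos_of_nonpos_of_nonneg (not_lt.mp hle) hε.le
    have hC : (0 : ℝ) ≤ C := Nat.cast_nonneg C
    linarith
  have hpos : 0 < n * dv := Nat.mul_pos (by exact_mod_cast hn0) hdv
  have hmean := SlepianWolf.abs_mean_sub_le P l h hpos
  have hsub := SlepianWolf.isSubGaussian_numIncorrect P l h
  have htail := hsub.tail_le (δ := n * dv * ε / 2)
    (fun w => mul_nonneg (by positivity) (Finset.prod_nonneg fun _ _ => ENNReal.toReal_nonneg))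
    (mul_pos hn0 hκ) (by positivity)
  rw [SlepianWolf.jointLaw_toReal]
  refine (Finset.sum_le_sum fun w _ => mul_le_mul_of_nonneg_left ?_
    (mul_nonneg (by positivity) (Finset.prod_nonneg fun _ _ => ENNReal.toReal_nonneg))).trans
    (htail.trans (le_of_eq ?_))
  · have hC : (C : ℝ) ≤ n * dv * ε / 2 := by
      have h1 : (1 : ℝ) ≤ dv := by exact_mod_cast hdv
      have h2 : (n : ℝ) * ε * 1 ≤ n * ε * dv := mul_le_mul_of_nonneg_left h1 (by positivity)
      nlinarith
    split_ifs with h1 h2 h2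
    · exact le_rfl
    -- A deviation beyond `n * dv * ε` from the tree value exceeds `n * dv * ε / 2` from the mean,
    -- by the triangle inequality with `hmean` and `hC`.
    · exfalso
      apply h2
      rw [Set.mem_ofPred_eq] at h1
      have := abs_sub_le (SlepianWolf.numIncorrect P l w.1 w.2)
        (∑ w : SlepianWolf.Graph dv dc n m × (Fin n → ZMod 2 × Y),
          (Fintype.card (SlepianWolf.Graph dv dc n m) : ℝ)⁻¹ * (∏ v, (P (w.2 v)).toReal) *
            SlepianWolf.numIncorrect P l w.1 w.2) (n * dv * SlepianWolf.errorProb P dv dc l)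
      linarith
    · exact zero_le_one
    · exact le_rfl
  · change 2 * Real.exp (-((n * dv * ε / 2) ^ 2 / (4 * (n * κ)))) = _
    congr 2
    field_simp
    ring
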